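/- Let $n\ge 3$, and let $X_1,\dots,X_n$ be independent random variables with common distribution $F$, where $F$ has a density $f$ that is positive and continuous on $(0,\infty)$ and zero on $(-\infty,0]$. Let $X_{(1)}\le\cdots\le X_{(n)}$ be the order statistics of $X_1,\dots,X_n$ and $\overline{X}_n=\frac1n\sum_{i=1}^n X_i$ the sample mean. Let $(a_{ij})_{i,j=1}^n$ be a positive definite real matrix, that is, $\sum_{i,j=1}^n a_{ij}v_iv_j>0$ for every nonzero $v\in\mathbb{R}^n$ (symmetry is not required), and set $$Z_n=\sum_{i=1}^n\sum_{j=1}^n a_{ij}\,(X_{(i)}-\overline{X}_n)(X_{(j)}-\overline{X}_n).$$ Then $\overline{X}_n$ and $Z_n^{1/2}/\overline{X}_n$ are independent if and only if $F$ is a gamma distribution, that is, there are $\alpha>0$ and $\beta>0$ such that $F$ has the density $\frac{1}{\Gamma(\alpha)\,\beta^{\alpha}}x^{\alpha-1}e^{-x/\beta}$ for $x>0$ and $0$ for $x\le 0$. -/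

import Mathlib

open MeasureTheory ProbabilityTheory

noncomputable section

/-- The sample mean of `x₁, …, xₙ`. -/
def sampleMean {n : ℕ} (x : Fin n → ℝ) : ℝ := (∑ i, x i) / n

/-- The order statistics `x₍₁₎ ≤ x₍₂₎ ≤ ⋯ ≤ x₍ₙ₎`: the values of `x`, with multiplicity, sorted
in nondecreasing order (indices start at `0`). -/
def orderStat {n : ℕ} (x : Fin n → ℝ) (i : Fin n) : ℝ := x (Tuple.sort x i)

theorem orderStat_monotone {n : ℕ} (x : Fin n → ℝ) : Monotone (orderStat x) :=
  Tuple.monotone_sort x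

/-- The quadratic form `∑ᵢ ∑ⱼ aᵢⱼ (x₍ᵢ₎ - x̄) (x₍ⱼ₎ - x̄)` in the centred order statistics. -/
def quadStat {n : ℕ} (a : Matrix (Fin n) (Fin n) ℝ) (x : Fin n → ℝ) : ℝ :=
  ∑ i, ∑ j, a i j * (orderStat x i - sampleMean x) * (orderStat x j - sampleMean x)

/-- `F` is a gamma distribution with some shape `a > 0` and scale `b > 0`. The second parameter of
`gammaMeasure` is the rate, that is, `1 / b`. -/
def IsGammaDistribution (F : Measure ℝ) : Prop :=
  ∃ a b : ℝ, 0 < a ∧ 0 < b ∧ F = gammaMeasure a (1 / b)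

end

/-! The statistic `R = ratioStat a` is invariant under positive scaling, while the mean is
homogeneous of degree one. Under a gamma law the joint density is `relProd x ^ b` times a function
of the mean, that is, an angular factor times a radial one. Lebesgue integrals of such products
split (`lintegral_radial_factor`, `lintegral_radial_cross`), so the mean and `R` are independent.

Conversely, a small value of `R` forces the sample close to the constant vector at its mean, so
independence lets the local shape of `f` at different points be compared. Suppose a kernel `q * y ^
b * exp (-(c * y))` touches `f` from above at `m₀`. Near the constant vector `m₀` the joint density
is then at most `relProd x ^ b` times a radial function, and is asymptotic to that radial function
as `R` tends to `0`. Hence `P (R ≤ ε) / P (R ≤ δ)` is at most about `ratioMass a b ε / ratioMass a 0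
δ`. A kernel with exponent `b'` touching `f` from below at some `m₁` gives the reverse bound with
`b'`. Together these yield `ratioMass a b' ε ≤ ratioMass a b ε`. By AM-GM, `relProd < 1` at
nonconstant positive vectors, so the mass strictly decreases in the exponent and `b ≤ b'`
(`exponent_le_of_touching`).

Failure of convexity of `log f - b log` produces a touching from above with exponent `b`, and
failure of concavity produces one from below. The exponents of the two kinds are therefore separated
by some `β`, at which `log f - β log` is both convex and concave, hence affine
(`exists_eq_log_add_affine`). No differentiability of `f` is needed. -/

/-! ### Angular and radial parts of integrals under scaling. -/

theorem lintegral_comp_smul_addHaar {E : Type*} [NormedAddCommGroup E] [NormedSpace ℝ E]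
    [MeasurableSpace E] [BorelSpace E] [FiniteDimensional ℝ E] (ν : Measure E) [ν.IsAddHaarMeasure]
    {g : E → ENNReal} (hg : Measurable g) {r : ℝ} (hr : 0 < r) :
    ∫⁻ x, g (r • x) ∂ν = ENNReal.ofReal ((r ^ Module.finrank ℝ E)⁻¹) * ∫⁻ x, g x ∂ν := by
  rw [← lintegral_map hg (measurable_const_smul r), Measure.map_addHaar_smul ν hr.ne',
    lintegral_smul_measure, abs_of_pos (by positivity), smul_eq_mul]

theorem lintegral_Ioi_eq_mul_lintegral_comp_mul {g : ℝ → ENNReal} (hg : Measurable g)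
    {r : ℝ} (hr : 0 < r) :
    ∫⁻ t in Set.Ioi 0, g t = ENNReal.ofReal r * ∫⁻ t in Set.Ioi 0, g (r * t) := by
  have h := lintegral_comp_smul_addHaar (volume : Measure ℝ)
    (hg.indicator (measurableSet_Ioi (a := (0 : ℝ)))) hr
  have h2 : ∀ t, (Set.Ioi (0 : ℝ)).indicator g (r • t)
      = (Set.Ioi (0 : ℝ)).indicator (fun t => g (r * t)) t := by
    intro t
    by_cases ht : 0 < t
    · simp [Set.indicator, ht, hr]
    · simp [Set.indicator, ht, hr]
  simp_rw [h2] at h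
  rw [lintegral_indicator measurableSet_Ioi, lintegral_indicator measurableSet_Ioi] at h
  rw [h, ← mul_assoc, ← ENNReal.ofReal_mul hr.le]
  simp [hr.ne']

/-- Integration of the product of a scale-invariant weight and a function of a
positively homogeneous radius factors into an angular and a radial part. -/
theorem lintegral_radial_factor {n : ℕ} {M : (Fin n → ℝ) → ℝ} (hM : Measurable M)
    (hMs : ∀ r : ℝ, 0 < r → ∀ x, M (r • x) = r * M x)
    {κ : ℝ → ENNReal} (hκ : Measurable κ)
    {w : (Fin n → ℝ) → ENNReal} (hw : Measurable w)
    (hws : ∀ r : ℝ, 0 < r → ∀ x, w (r • x) = w x) (hw0 : ∀ x, w x ≠ 0 → 0 < M x)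
    {φ : ℝ → ENNReal} (hφ : Measurable φ) :
    (∫⁻ s in Set.Ioi (0 : ℝ), κ s⁻¹ * ENNReal.ofReal ((s ^ n)⁻¹ * s⁻¹)) * ∫⁻ x, w x * φ (M x)
      = (∫⁻ x, w x * κ (M x)) * ∫⁻ r in Set.Ioi (0 : ℝ), ENNReal.ofReal (r ^ n / r) * φ r := by
  symm
  -- Polar coordinates without a surface measure: substitute `r = M x * t`, swap, replace `x` by
  -- `t⁻¹ • x` so that `φ` no longer sees `t`, swap back, and substitute `t = M x * s` so that `κ`
  -- no longer sees `x`.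
  calc (∫⁻ x, w x * κ (M x)) * ∫⁻ r in Set.Ioi (0 : ℝ), ENNReal.ofReal (r ^ n / r) * φ r
      = ∫⁻ x, w x * κ (M x) * ∫⁻ r in Set.Ioi (0 : ℝ), ENNReal.ofReal (r ^ n / r) * φ r := by
        rw [lintegral_mul_const _ (by fun_prop)]
    _ = ∫⁻ x, ∫⁻ t in Set.Ioi (0 : ℝ), w x * κ (M x) * (ENNReal.ofReal (M x) *
          (ENNReal.ofReal ((M x * t) ^ n / (M x * t)) * φ (M x * t))) := by
        congr 1 with x
        by_cases hx : w x = 0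
        · simp [hx]
        rw [lintegral_Ioi_eq_mul_lintegral_comp_mul (by fun_prop) (hw0 x hx),
          ← lintegral_const_mul _ (by fun_prop), ← lintegral_const_mul _ (by fun_prop)]
    _ = ∫⁻ t in Set.Ioi (0 : ℝ), ∫⁻ x, w x * κ (M x) * (ENNReal.ofReal (M x) *
          (ENNReal.ofReal ((M x * t) ^ n / (M x * t)) * φ (M x * t))) := by
        apply lintegral_lintegral_swap
        apply Measurable.aemeasurable
        fun_prop
    _ = ∫⁻ t in Set.Ioi (0 : ℝ), ENNReal.ofReal (t ^ n)⁻¹ * ∫⁻ x, w x * κ (M x * t⁻¹) *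
          (ENNReal.ofReal (M x * t⁻¹) * (ENNReal.ofReal ((M x) ^ n / (M x)) * φ (M x))) := by
        apply setLIntegral_congr_fun measurableSet_Ioi
        intro t (ht : 0 < t)
        have h := lintegral_comp_smul_addHaar (volume : Measure (Fin n → ℝ))
          (g := fun x => w x * κ (M x * t⁻¹) *
          (ENNReal.ofReal (M x * t⁻¹) * (ENNReal.ofReal ((M x) ^ n / (M x)) * φ (M x))))
          (by fun_prop) ht
        simp only [Module.finrank_fin_fun] at h
        beta_reduce
        rw [← h]
        congr 1 with x
        rw [hws t ht, hMs t ht, mul_comm t, mul_assoc (M x) t, mul_inv_cancel₀ ht.ne', mul_one]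
    _ = ∫⁻ t in Set.Ioi (0 : ℝ), ∫⁻ x, ENNReal.ofReal (t ^ n)⁻¹ * (w x * κ (M x * t⁻¹) *
          (ENNReal.ofReal (M x * t⁻¹) * (ENNReal.ofReal ((M x) ^ n / (M x)) * φ (M x)))) := by
        congr 1 with t
        rw [lintegral_const_mul _ (by fun_prop)]
    _ = ∫⁻ x, ∫⁻ t in Set.Ioi (0 : ℝ), ENNReal.ofReal (t ^ n)⁻¹ * (w x * κ (M x * t⁻¹) *
          (ENNReal.ofReal (M x * t⁻¹) * (ENNReal.ofReal ((M x) ^ n / (M x)) * φ (M x)))) := by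
        apply lintegral_lintegral_swap
        apply Measurable.aemeasurable
        fun_prop
    _ = ∫⁻ x, (∫⁻ s in Set.Ioi (0 : ℝ), κ s⁻¹ * ENNReal.ofReal ((s ^ n)⁻¹ * s⁻¹)) *
          (w x * φ (M x)) := by
        congr 1 with x
        by_cases hx : w x = 0
        · simp [hx]
        have hm := hw0 x hx
        rw [lintegral_Ioi_eq_mul_lintegral_comp_mul (by fun_prop) hm,
          ← lintegral_const_mul _ (by fun_prop), ← lintegral_mul_const _ (by fun_prop)]
        apply setLIntegral_congr_fun measurableSet_Ioi
        intro s (hs : 0 < s)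
        have e1 : M x * (M x * s)⁻¹ = s⁻¹ := by field_simp
        have e2 : ENNReal.ofReal ((s ^ n)⁻¹ * s⁻¹) = ENNReal.ofReal (M x) *
          (ENNReal.ofReal ((M x * s) ^ n)⁻¹ * (ENNReal.ofReal s⁻¹ *
            ENNReal.ofReal (M x ^ n / M x))) := by
          rw [← ENNReal.ofReal_mul (by positivity), ← ENNReal.ofReal_mul (by positivity),
            ← ENNReal.ofReal_mul (by positivity)]
          congr 1
          field_simp
          rw [mul_pow, mul_comm]
        simp only [e1, e2]
        ring
    _ = _ := by rw [lintegral_const_mul _ (by fun_prop)]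

/-- This radial constant has to be cancelled in `ENNReal`. The bump restricts `s` to `(1/2, 1)`,
where the integrand is positive and bounded. -/
theorem lintegral_Ioi_bump_ne {n : ℕ} :
    (∫⁻ s in Set.Ioi (0 : ℝ), (Set.Ioo (1 : ℝ) 2).indicator 1 s⁻¹ *
      ENNReal.ofReal ((s ^ n)⁻¹ * s⁻¹)) ≠ 0 ∧
    (∫⁻ s in Set.Ioi (0 : ℝ), (Set.Ioo (1 : ℝ) 2).indicator 1 s⁻¹ *
      ENNReal.ofReal ((s ^ n)⁻¹ * s⁻¹)) ≠ ⊤ := by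
  have hmem : ∀ s : ℝ, 0 < s → (s⁻¹ ∈ Set.Ioo (1 : ℝ) 2 ↔ s ∈ Set.Ioo (1 / 2 : ℝ) 1) := by
    intro s hs
    simp only [Set.mem_Ioo, one_lt_inv₀ hs, inv_lt_comm₀ hs two_pos]
    constructor
    · rintro ⟨h1, h2⟩; exact ⟨by linarith, h1⟩
    · rintro ⟨h1, h2⟩; exact ⟨h2, by linarith⟩
  have h : (∫⁻ s in Set.Ioi (0 : ℝ), (Set.Ioo (1 : ℝ) 2).indicator 1 s⁻¹ *
      ENNReal.ofReal ((s ^ n)⁻¹ * s⁻¹))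
      = ∫⁻ s in Set.Ioo (1 / 2 : ℝ) 1, ENNReal.ofReal ((s ^ n)⁻¹ * s⁻¹) := by
    rw [← lintegral_indicator measurableSet_Ioi, ← lintegral_indicator measurableSet_Ioo]
    congr 1 with s
    by_cases hs : 0 < s
    · by_cases h2 : s ∈ Set.Ioo (1 / 2 : ℝ) 1
      · have := (hmem s hs).2 h2
        simp only [Set.indicator, this, h2, Set.mem_Ioi, hs]; simp
      · have h3 := fun hh => h2 ((hmem s hs).1 hh)
        rw [Set.indicator_of_mem (Set.mem_Ioi.2 hs), Set.indicator_of_notMem h2,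
          Set.indicator_of_notMem h3, zero_mul]
    · have h2 : s ∉ Set.Ioo (1 / 2 : ℝ) 1 := fun h => hs (by linarith [h.1])
      simp only [Set.indicator, h2, Set.mem_Ioi, hs]; simp
  rw [h]
  constructor
  · apply ne_of_gt
    refine (setLIntegral_pos_iff (by fun_prop)).2 ?_
    have : (Set.Ioo (1 / 2 : ℝ) 1) ⊆
        Function.support (fun s : ℝ => ENNReal.ofReal ((s ^ n)⁻¹ * s⁻¹)) := by
      intro s hs
      have : 0 < s := by linarith [hs.1]
      simp only [Function.mem_support, ne_eq, ENNReal.ofReal_eq_zero, not_le]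
      positivity
    rw [Set.inter_eq_right.2 this]
    norm_num
  · refine ne_top_of_le_ne_top (b := ENNReal.ofReal (2 ^ n * 2) * volume (Set.Ioo (1 / 2 : ℝ) 1))
      (by simp [ENNReal.mul_eq_top]) ?_
    rw [← setLIntegral_const]
    apply setLIntegral_mono (by fun_prop)
    intro s hs
    have hs0 : 0 < s := by linarith [hs.1]
    have : s⁻¹ ≤ 2 := ((hmem s hs0).2 hs).2.le
    apply ENNReal.ofReal_le_ofReal
    rw [← inv_pow]
    gcongr

/-- Up to one common constant, each integral is an angular number times a radial number, so
exchanging the two radial functions does not change the product. -/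
theorem lintegral_radial_cross {n : ℕ} {M : (Fin n → ℝ) → ℝ} (hM : Measurable M)
    (hMs : ∀ r : ℝ, 0 < r → ∀ x, M (r • x) = r * M x)
    {w w' : (Fin n → ℝ) → ENNReal} (hw : Measurable w)
    (hws : ∀ r : ℝ, 0 < r → ∀ x, w (r • x) = w x) (hw0 : ∀ x, w x ≠ 0 → 0 < M x)
    (hw' : Measurable w')
    (hws' : ∀ r : ℝ, 0 < r → ∀ x, w' (r • x) = w' x) (hw0' : ∀ x, w' x ≠ 0 → 0 < M x)
    {φ φ' : ℝ → ENNReal} (hφ : Measurable φ) (hφ' : Measurable φ') :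
    (∫⁻ x, w x * φ (M x)) * ∫⁻ x, w' x * φ' (M x)
      = (∫⁻ x, w x * φ' (M x)) * ∫⁻ x, w' x * φ (M x) := by
  have hκ : Measurable ((Set.Ioo (1 : ℝ) 2).indicator (1 : ℝ → ENNReal)) :=
    measurable_one.indicator measurableSet_Ioo
  obtain ⟨h0, ht⟩ := lintegral_Ioi_bump_ne (n := n)
  have h1 := lintegral_radial_factor hM hMs hκ hw hws hw0 hφ
  have h2 := lintegral_radial_factor hM hMs hκ hw hws hw0 hφ'
  have h3 := lintegral_radial_factor hM hMs hκ hw' hws' hw0' hφ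
  have h4 := lintegral_radial_factor hM hMs hκ hw' hws' hw0' hφ'
  set C := ∫⁻ s in Set.Ioi (0 : ℝ), (Set.Ioo (1 : ℝ) 2).indicator 1 s⁻¹ *
      ENNReal.ofReal ((s ^ n)⁻¹ * s⁻¹)
  rw [← ENNReal.mul_right_inj (mul_ne_zero h0 h0) (ENNReal.mul_ne_top ht ht),
    mul_mul_mul_comm, h1, h4, mul_mul_mul_comm C, h2, h3]
  ring

/-! ### Product densities. -/

theorem lintegral_fin_prod_eq_prod {n : ℕ} {g : Fin n → ℝ → ENNReal}
    (hg : ∀ i, Measurable (g i)) :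
    ∫⁻ x : Fin n → ℝ, ∏ i, g i (x i) = ∏ i, ∫⁻ t, g i t := by
  induction n with
  | zero => simp [volume_pi]
  | succ n ih =>
    have h1 := (volume_preserving_piFinSuccAbove (fun _ : Fin (n + 1) => ℝ) 0).symm.lintegral_comp
      (f := fun x : Fin (n + 1) → ℝ => ∏ i, g i (x i)) (by fun_prop)
    rw [← h1, Fin.prod_univ_succ, ← ih (fun i => hg i.succ),
      ← lintegral_prod_mul (hg 0).aemeasurable
        (Finset.measurable_prod _ fun i _ => (hg i.succ).comp (measurable_pi_apply i)).aemeasurable]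
    congr 1 with x
    simp [Fin.prod_univ_succ, MeasurableEquiv.piFinSuccAbove_symm_apply, Fin.insertNthEquiv]

theorem pi_withDensity_eq {n : ℕ} {g : ℝ → ENNReal} (hg : Measurable g)
    [SigmaFinite (volume.withDensity g)] :
    Measure.pi (fun _ : Fin n => volume.withDensity g)
      = (volume : Measure (Fin n → ℝ)).withDensity (fun x => ∏ i, g (x i)) := by
  apply Measure.pi_eq
  intro s hs
  rw [withDensity_apply _ (MeasurableSet.univ_pi hs),
    ← lintegral_indicator (MeasurableSet.univ_pi hs)]
  have : ∀ x : Fin n → ℝ, (Set.univ.pi s).indicator (fun x => ∏ i, g (x i)) x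
      = ∏ i, (s i).indicator g (x i) := by
    intro x
    by_cases hx : x ∈ Set.univ.pi s
    · rw [Set.indicator_of_mem hx]
      exact Finset.prod_congr rfl fun i _ => (Set.indicator_of_mem (hx i trivial) _).symm
    · rw [Set.indicator_of_notMem hx]
      simp only [Set.mem_pi, Set.mem_univ, true_imp_iff, not_forall] at hx
      obtain ⟨i, hi⟩ := hx
      exact (Finset.prod_eq_zero (Finset.mem_univ i) (Set.indicator_of_notMem hi _)).symm
  simp_rw [this]
  rw [lintegral_fin_prod_eq_prod (fun i => hg.indicator (hs i))]
  exact Finset.prod_congr rfl fun i _ => by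
    rw [lintegral_indicator (hs i), withDensity_apply _ (hs i)]

/-! ### Homogeneity, measurability and size of the statistics. -/

theorem sampleMean_smul {n : ℕ} (r : ℝ) (x : Fin n → ℝ) :
    sampleMean (r • x) = r * sampleMean x := by
  simp [sampleMean, ← Finset.mul_sum, mul_div_assoc]

@[fun_prop]
theorem continuous_sampleMean {n : ℕ} : Continuous (sampleMean : (Fin n → ℝ) → ℝ) := by
  unfold sampleMean
  fun_prop

@[fun_prop]
theorem measurable_sampleMean {n : ℕ} : Measurable (sampleMean : (Fin n → ℝ) → ℝ) :=
  continuous_sampleMean.measurable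

theorem sum_eq_mul_sampleMean {n : ℕ} (hn : n ≠ 0) (x : Fin n → ℝ) :
    ∑ i, x i = n * sampleMean x := by
  have : (n : ℝ) ≠ 0 := by exact_mod_cast hn
  rw [sampleMean]
  field_simp

theorem sampleMean_pos {n : ℕ} (hn : n ≠ 0) {x : Fin n → ℝ} (hx : ∀ i, 0 < x i) :
    0 < sampleMean x := by
  have : NeZero n := ⟨hn⟩
  exact div_pos (Finset.sum_pos (fun i _ => hx i) Finset.univ_nonempty)
    (by exact_mod_cast Nat.pos_of_ne_zero hn)

theorem orderStat_smul {n : ℕ} {r : ℝ} (hr : 0 < r) (x : Fin n → ℝ) :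
    orderStat (r • x) = r • orderStat x := by
  have h : Monotone ((r • x) ∘ Tuple.sort x) := fun i j hij =>
    mul_le_mul_of_nonneg_left (Tuple.monotone_sort x hij) hr.le
  have := Tuple.comp_sort_eq_comp_iff_monotone.2 h
  exact this.symm

/-- The sorting permutation takes finitely many values, and each fibre is cut out by comparisons of
coordinates, ties being broken by index. -/
theorem measurable_orderStat {n : ℕ} (i : Fin n) :
    Measurable (fun x : Fin n → ℝ => orderStat x i) := by
  let _ : MeasurableSpace (Equiv.Perm (Fin n)) := ⊤
  have hs : Measurable (fun x : Fin n → ℝ => Tuple.sort x) := by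
    apply measurable_to_countable'
    intro σ
    have : (fun x : Fin n → ℝ => Tuple.sort x) ⁻¹' {σ} = {x | (∀ i j, i ≤ j → x (σ i) ≤ x (σ j)) ∧
        ∀ i j, i < j → x (σ i) = x (σ j) → σ i < σ j} := by
      ext x
      simp only [Set.mem_preimage, Set.mem_singleton_iff, Set.mem_ofPred_eq]
      rw [eq_comm, Tuple.eq_sort_iff]
      rfl
    rw [this]
    measurability
  have h2 : Measurable (fun p : Equiv.Perm (Fin n) × (Fin n → ℝ) => p.2 (p.1 i)) :=
    measurable_from_prod_countable_right fun σ => measurable_pi_apply (σ i)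
  exact h2.comp (hs.prodMk measurable_id)

theorem quadStat_smul {n : ℕ} (a : Matrix (Fin n) (Fin n) ℝ) {r : ℝ} (hr : 0 < r)
    (x : Fin n → ℝ) : quadStat a (r • x) = r ^ 2 * quadStat a x := by
  simp only [quadStat, orderStat_smul hr, sampleMean_smul, Finset.mul_sum, Pi.smul_apply,
    smul_eq_mul]
  refine Finset.sum_congr rfl fun i _ => Finset.sum_congr rfl fun j _ => ?_
  ring

theorem measurable_quadStat {n : ℕ} (a : Matrix (Fin n) (Fin n) ℝ) : Measurable (quadStat a) := by
  have := measurable_orderStat (n := n)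
  unfold quadStat
  fun_prop

/-- The ratio `√Z / x̄` of the root quadratic statistic to the sample mean. -/
noncomputable def ratioStat {n : ℕ} (a : Matrix (Fin n) (Fin n) ℝ) (x : Fin n → ℝ) : ℝ :=
  Real.sqrt (quadStat a x) / sampleMean x

@[fun_prop]
theorem measurable_ratioStat {n : ℕ} (a : Matrix (Fin n) (Fin n) ℝ) : Measurable (ratioStat a) := by
  have := measurable_quadStat a
  unfold ratioStat
  fun_prop

theorem ratioStat_smul {n : ℕ} (a : Matrix (Fin n) (Fin n) ℝ) {r : ℝ} (hr : 0 < r)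
    (x : Fin n → ℝ) : ratioStat a (r • x) = ratioStat a x := by
  rw [ratioStat, quadStat_smul a hr, sampleMean_smul, Real.sqrt_mul (by positivity),
    Real.sqrt_sq hr.le, mul_div_mul_left _ _ hr.ne', ratioStat]

theorem exists_pos_mul_sq_norm_le {n : ℕ} {a : Matrix (Fin n) (Fin n) ℝ}
    (ha : ∀ v : Fin n → ℝ, v ≠ 0 → 0 < ∑ i, ∑ j, a i j * v i * v j) :
    ∃ c > 0, ∀ v : Fin n → ℝ, c * ‖v‖ ^ 2 ≤ ∑ i, ∑ j, a i j * v i * v j := by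
  have hcont : Continuous (fun v : Fin n → ℝ => ∑ i, ∑ j, a i j * v i * v j) := by fun_prop
  rcases (Metric.sphere (0 : Fin n → ℝ) 1).eq_empty_or_nonempty with h | h
  · refine ⟨1, one_pos, fun v => ?_⟩
    by_cases hv : v = 0
    · simp [hv]
    · exfalso
      have : ‖v‖⁻¹ • v ∈ Metric.sphere (0 : Fin n → ℝ) 1 := by
        simp [norm_smul, norm_ne_zero_iff.2 hv]
      rw [h] at this
      exact this
  · obtain ⟨u, hu, hmin⟩ := (isCompact_sphere (0 : Fin n → ℝ) 1).exists_isMinOn h hcont.continuousOn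
    have hu0 : u ≠ 0 := by
      rintro rfl
      simp at hu
    refine ⟨_, ha u hu0, fun v => ?_⟩
    by_cases hv : v = 0
    · simp [hv]
    · have hv' : 0 < ‖v‖ := norm_pos_iff.2 hv
      have : ‖v‖⁻¹ • v ∈ Metric.sphere (0 : Fin n → ℝ) 1 := by
        simp [norm_smul, norm_ne_zero_iff.2 hv]
      have h1 := hmin this
      simp only [Set.mem_ofPred_eq, Pi.smul_apply, smul_eq_mul] at h1
      have h2 : ∑ i, ∑ j, a i j * (‖v‖⁻¹ * v i) * (‖v‖⁻¹ * v j)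
          = (‖v‖ ^ 2)⁻¹ * ∑ i, ∑ j, a i j * v i * v j := by
        simp only [Finset.mul_sum]
        refine Finset.sum_congr rfl fun i _ => Finset.sum_congr rfl fun j _ => ?_
        field_simp
      rw [h2] at h1
      calc _ ≤ ((‖v‖ ^ 2)⁻¹ * ∑ i, ∑ j, a i j * v i * v j) * ‖v‖ ^ 2 := by gcongr
        _ = _ := by field_simp

/-- Positive definiteness enters the argument through this bound: a small ratio forces every
coordinate close to the mean. -/
theorem exists_abs_sub_sampleMean_le {n : ℕ} {a : Matrix (Fin n) (Fin n) ℝ}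
    (ha : ∀ v : Fin n → ℝ, v ≠ 0 → 0 < ∑ i, ∑ j, a i j * v i * v j) :
    ∃ K > 0, ∀ x : Fin n → ℝ, 0 < sampleMean x →
      ∀ i, |x i - sampleMean x| ≤ K * ratioStat a x * sampleMean x := by
  obtain ⟨c, hc, h⟩ := exists_pos_mul_sq_norm_le ha
  refine ⟨(√c)⁻¹, by positivity, fun x hx i => ?_⟩
  rw [ratioStat, mul_assoc, div_mul_cancel₀ _ hx.ne', inv_mul_eq_div,
    le_div_iff₀ (by positivity)]
  apply Real.le_sqrt_of_sq_le
  have h1 := h (fun i => orderStat x i - sampleMean x)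
  -- The inverse of the sorting permutation gives the rank at which `x i` appears among the order
  -- statistics.
  have h2 := norm_le_pi_norm (fun i => orderStat x i - sampleMean x) ((Tuple.sort x).symm i)
  simp only [orderStat, Equiv.apply_symm_apply, Real.norm_eq_abs] at h2
  calc _ = c * |x i - sampleMean x| ^ 2 := by rw [mul_pow, Real.sq_sqrt hc.le, mul_comm]
    _ ≤ c * ‖fun i => orderStat x i - sampleMean x‖ ^ 2 := by
      gcongr
      exact h2
    _ ≤ _ := h1

theorem exists_ratioStat_le {n : ℕ} (a : Matrix (Fin n) (Fin n) ℝ) :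
    ∃ K > 0, ∀ x : Fin n → ℝ, 0 < sampleMean x → ∀ t ≥ 0,
      (∀ i, |x i - sampleMean x| ≤ t * sampleMean x) → ratioStat a x ≤ K * t := by
  refine ⟨√(∑ i, ∑ j, |a i j|) + 1, by positivity, fun x hx t ht h => ?_⟩
  have hS : 0 ≤ ∑ i, ∑ j, |a i j| := by positivity
  rw [ratioStat, div_le_iff₀ hx]
  apply Real.sqrt_le_iff.2 ⟨by positivity, ?_⟩
  calc quadStat a x ≤ ∑ i, ∑ j, |a i j| * (t * sampleMean x) ^ 2 := by
        refine Finset.sum_le_sum fun i _ => Finset.sum_le_sum fun j _ => ?_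
        calc _ ≤ |a i j * (orderStat x i - sampleMean x) * (orderStat x j - sampleMean x)| :=
              le_abs_self _
          _ = |a i j| * (|orderStat x i - sampleMean x| * |orderStat x j - sampleMean x|) := by
              rw [abs_mul, abs_mul, mul_assoc]
          _ ≤ |a i j| * ((t * sampleMean x) * (t * sampleMean x)) := by
              gcongr
              · exact h _
              · exact h _
          _ = _ := by ring
    _ = √(∑ i, ∑ j, |a i j|) ^ 2 * (t * sampleMean x) ^ 2 := by
        rw [Real.sq_sqrt hS]
        simp only [Finset.sum_mul]
    _ ≤ (√(∑ i, ∑ j, |a i j|) + 1) ^ 2 * (t * sampleMean x) ^ 2 := by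
        gcongr
        linarith
    _ = _ := by ring

/-! ### The angular factor and AM-GM. -/

/-- The product of the coordinates relative to the sample mean. -/
noncomputable def relProd {n : ℕ} (x : Fin n → ℝ) : ℝ := ∏ i, x i / sampleMean x

@[fun_prop]
theorem measurable_relProd {n : ℕ} : Measurable (relProd : (Fin n → ℝ) → ℝ) := by
  unfold relProd
  fun_prop

theorem relProd_smul {n : ℕ} {r : ℝ} (hr : 0 < r) (x : Fin n → ℝ) :
    relProd (r • x) = relProd x := by
  simp only [relProd, sampleMean_smul, Pi.smul_apply, smul_eq_mul]
  exact Finset.prod_congr rfl fun i _ => mul_div_mul_left _ _ hr.ne'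

theorem relProd_pos {n : ℕ} (hn : n ≠ 0) {x : Fin n → ℝ} (hx : ∀ i, 0 < x i) : 0 < relProd x :=
  Finset.prod_pos fun i _ => div_pos (hx i) (sampleMean_pos hn hx)

theorem sum_div_sampleMean_sub_one {n : ℕ} (hn : n ≠ 0) {x : Fin n → ℝ} (hx : ∀ i, 0 < x i) :
    ∑ i, (x i / sampleMean x - 1) = 0 := by
  rw [Finset.sum_sub_distrib, ← Finset.sum_div, sum_eq_mul_sampleMean hn,
    mul_div_cancel_right₀ _ (sampleMean_pos hn hx).ne']
  simp

theorem log_relProd {n : ℕ} (hn : n ≠ 0) {x : Fin n → ℝ} (hx : ∀ i, 0 < x i) :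
    Real.log (relProd x) = ∑ i, Real.log (x i / sampleMean x) :=
  Real.log_prod fun i _ => (div_pos (hx i) (sampleMean_pos hn hx)).ne'

/-- AM-GM: sum `log u ≤ u - 1` over `u = x i / sampleMean x`; the right-hand sides sum to zero. -/
theorem relProd_le_one {n : ℕ} (hn : n ≠ 0) {x : Fin n → ℝ} (hx : ∀ i, 0 < x i) :
    relProd x ≤ 1 := by
  rw [← Real.log_nonpos_iff (relProd_pos hn hx).le, log_relProd hn hx,
    ← sum_div_sampleMean_sub_one hn hx]
  exact Finset.sum_le_sum fun i _ =>
    Real.log_le_sub_one_of_pos (div_pos (hx i) (sampleMean_pos hn hx))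

theorem relProd_lt_one {n : ℕ} (hn : n ≠ 0) {x : Fin n → ℝ} (hx : ∀ i, 0 < x i) {k l : Fin n}
    (hkl : x k ≠ x l) : relProd x < 1 := by
  have hm := sampleMean_pos hn hx
  rw [← Real.log_neg_iff (relProd_pos hn hx), log_relProd hn hx,
    ← sum_div_sampleMean_sub_one hn hx]
  obtain ⟨i, hi⟩ : ∃ i, x i ≠ sampleMean x := by
    by_contra! h
    exact hkl ((h k).trans (h l).symm)
  refine Finset.sum_lt_sum (fun i _ => Real.log_le_sub_one_of_pos (div_pos (hx i) hm))
    ⟨i, Finset.mem_univ i, Real.log_lt_sub_one_of_pos (div_pos (hx i) hm) ?_⟩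
  rwa [ne_eq, div_eq_one_iff_eq hm.ne']

/-- The open set has positive volume. It makes the monotonicity of `ratioMass` strict and gives
small ratios positive probability. -/
theorem exists_isOpen_nonconst {n : ℕ} (hn : 2 ≤ n) (a : Matrix (Fin n) (Fin n) ℝ) {ε : ℝ}
    (hε : 0 < ε) :
    ∃ O : Set (Fin n → ℝ), IsOpen O ∧ O.Nonempty ∧ ∀ x ∈ O, (∀ i, 0 < x i) ∧ ratioStat a x ≤ ε ∧
      sampleMean x ∈ Set.Ioo 1 2 ∧ ∃ k l, x k ≠ x l := by
  obtain ⟨K, hK, h⟩ := exists_ratioStat_le a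
  set t := min (ε / K) (1 / 2) with ht
  have ht0 : 0 < t := by positivity
  have ht1 : t ≤ 1 / 2 := min_le_right _ _
  have htε : K * t ≤ ε := by
    calc K * t ≤ K * (ε / K) := by gcongr; exact min_le_left _ _
      _ = ε := by field_simp
  let k : Fin n := ⟨0, by omega⟩
  let l : Fin n := ⟨1, by omega⟩
  have hkl : k ≠ l := by simp [k, l]
  refine ⟨{x | (∀ i, |x i - sampleMean x| < t * sampleMean x) ∧ sampleMean x ∈ Set.Ioo 1 2 ∧
    x k ≠ x l}, ?_, ?_, ?_⟩
  · have h1 : IsOpen {x : Fin n → ℝ | ∀ i, |x i - sampleMean x| < t * sampleMean x} := by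
      have : {x : Fin n → ℝ | ∀ i, |x i - sampleMean x| < t * sampleMean x}
          = ⋂ i, {x : Fin n → ℝ | |x i - sampleMean x| < t * sampleMean x} := by
        ext; simp
      rw [this]
      exact isOpen_iInter_of_finite fun i => isOpen_lt (by fun_prop) (by fun_prop)
    have h2 : IsOpen {x : Fin n → ℝ | sampleMean x ∈ Set.Ioo 1 2} :=
      isOpen_Ioo.preimage continuous_sampleMean
    have h3 : IsOpen {x : Fin n → ℝ | x k ≠ x l} :=
      isOpen_ne_fun (continuous_apply k) (continuous_apply l)
    exact h1.inter (h2.inter h3)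
  · have hn0 : (n : ℝ) ≠ 0 := by positivity
    -- Moving two coordinates by `t` in opposite directions keeps the mean at `3 / 2`, with
    -- deviations at most `t < t * (3 / 2)`.
    let x : Fin n → ℝ := fun i => 3 / 2 + ((if i = k then t else 0) - (if i = l then t else 0))
    have hm : sampleMean x = 3 / 2 := by
      simp only [sampleMean, x, Finset.sum_add_distrib, Finset.sum_sub_distrib]
      simp
      field_simp
    have hb : ∀ i, |x i - 3 / 2| ≤ t := by
      intro i
      have : x i - 3 / 2 = (if i = k then t else 0) - (if i = l then t else 0) := by
        simp only [x]; ring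
      rw [this]
      split_ifs <;> simp [abs_of_pos, ht0, ht0.le]
    refine ⟨x, fun i => ?_, ?_, ?_⟩
    · rw [hm]
      linarith [hb i]
    · rw [hm]; norm_num
    · simp only [x, hkl, hkl.symm, if_true, if_false]
      intro hh
      linarith
  · rintro x ⟨hx, hm, hne⟩
    have hm0 : 0 < sampleMean x := by linarith [hm.1]
    refine ⟨fun i => ?_, (h x hm0 t ht0.le fun i => (hx i).le).trans htε, hm, k, l, hne⟩
    have := (abs_lt.1 (hx i)).1
    nlinarith

/-! ### Scale-invariant weights and the gamma kernel. -/

/-- The scale-invariant weight `(∏ xᵢ / x̄) ^ b` on the positive vectors `x` whose ratio statistic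
lies in `t`. -/
noncomputable def ratioWeight {n : ℕ} (a : Matrix (Fin n) (Fin n) ℝ) (b : ℝ) (t : Set ℝ) :
    (Fin n → ℝ) → ENNReal :=
  {x | (∀ i, 0 < x i) ∧ ratioStat a x ∈ t}.indicator fun x => ENNReal.ofReal (relProd x ^ b)

theorem measurableSet_pos_ratioStat {n : ℕ} (a : Matrix (Fin n) (Fin n) ℝ) {t : Set ℝ}
    (ht : MeasurableSet t) : MeasurableSet {x : Fin n → ℝ | (∀ i, 0 < x i) ∧ ratioStat a x ∈ t} := by
  have := measurable_ratioStat a ht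
  have h : MeasurableSet {x : Fin n → ℝ | ∀ i, 0 < x i} := by measurability
  exact h.inter this

theorem ratioWeight_of_mem {n : ℕ} (a : Matrix (Fin n) (Fin n) ℝ) (b : ℝ) {t : Set ℝ}
    {x : Fin n → ℝ} (hx : ∀ i, 0 < x i) (hxt : ratioStat a x ∈ t) :
    ratioWeight a b t x = ENNReal.ofReal (relProd x ^ b) :=
  Set.indicator_of_mem (s := {x : Fin n → ℝ | (∀ i, 0 < x i) ∧ ratioStat a x ∈ t}) ⟨hx, hxt⟩ _

theorem ratioWeight_of_notMem {n : ℕ} (a : Matrix (Fin n) (Fin n) ℝ) (b : ℝ) {t : Set ℝ}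
    {x : Fin n → ℝ} (hx : ¬((∀ i, 0 < x i) ∧ ratioStat a x ∈ t)) : ratioWeight a b t x = 0 :=
  Set.indicator_of_notMem (s := {x : Fin n → ℝ | (∀ i, 0 < x i) ∧ ratioStat a x ∈ t}) hx _

theorem measurable_ratioWeight {n : ℕ} (a : Matrix (Fin n) (Fin n) ℝ) (b : ℝ) {t : Set ℝ}
    (ht : MeasurableSet t) : Measurable (ratioWeight a b t) :=
  Measurable.indicator (by fun_prop) (measurableSet_pos_ratioStat a ht)

theorem ratioWeight_smul {n : ℕ} (a : Matrix (Fin n) (Fin n) ℝ) (b : ℝ) (t : Set ℝ) {r : ℝ}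
    (hr : 0 < r) (x : Fin n → ℝ) : ratioWeight a b t (r • x) = ratioWeight a b t x := by
  have h : r • x ∈ {x : Fin n → ℝ | (∀ i, 0 < x i) ∧ ratioStat a x ∈ t} ↔
      x ∈ {x : Fin n → ℝ | (∀ i, 0 < x i) ∧ ratioStat a x ∈ t} := by
    simp [ratioStat_smul a hr, hr]
  by_cases hx : x ∈ {x : Fin n → ℝ | (∀ i, 0 < x i) ∧ ratioStat a x ∈ t}
  · rw [ratioWeight, Set.indicator_of_mem hx, Set.indicator_of_mem (h.2 hx), relProd_smul hr]
  · rw [ratioWeight, Set.indicator_of_notMem hx, Set.indicator_of_notMem (fun hh => hx (h.1 hh))]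

theorem sampleMean_pos_of_ratioWeight {n : ℕ} (hn : n ≠ 0) (a : Matrix (Fin n) (Fin n) ℝ) (b : ℝ)
    (t : Set ℝ) (x : Fin n → ℝ) (hx : ratioWeight a b t x ≠ 0) : 0 < sampleMean x :=
  sampleMean_pos hn (Set.mem_of_indicator_ne_zero hx).1

theorem lintegral_ratioWeight_cross {n : ℕ} (hn : n ≠ 0) (a : Matrix (Fin n) (Fin n) ℝ) (b b' : ℝ)
    {t t' : Set ℝ} (ht : MeasurableSet t) (ht' : MeasurableSet t') {φ φ' : ℝ → ENNReal}
    (hφ : Measurable φ) (hφ' : Measurable φ') :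
    (∫⁻ x, ratioWeight a b t x * φ (sampleMean x)) *
        ∫⁻ x, ratioWeight a b' t' x * φ' (sampleMean x)
      = (∫⁻ x, ratioWeight a b t x * φ' (sampleMean x)) *
        ∫⁻ x, ratioWeight a b' t' x * φ (sampleMean x) :=
  lintegral_radial_cross measurable_sampleMean (fun r _ x => sampleMean_smul r x)
    (measurable_ratioWeight a b ht) (fun _ hr x => ratioWeight_smul a b t hr x)
    (sampleMean_pos_of_ratioWeight hn a b t)
    (measurable_ratioWeight a b' ht') (fun _ hr x => ratioWeight_smul a b' t' hr x)
    (sampleMean_pos_of_ratioWeight hn a b' t') hφ hφ'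

theorem prod_gamma_kernel {n : ℕ} (hn : n ≠ 0) (A b c : ℝ) {x : Fin n → ℝ} (hx : ∀ i, 0 < x i) :
    ∏ i, A * x i ^ b * Real.exp (-(c * x i))
      = relProd x ^ b *
        (A ^ n * (sampleMean x ^ n) ^ b * Real.exp (-(c * (n * sampleMean x)))) := by
  have hm := sampleMean_pos hn hx
  have h1 : ∏ i, x i = relProd x * sampleMean x ^ n := by
    simp only [relProd, Finset.prod_div_distrib, Finset.prod_const, Finset.card_univ,
      Fintype.card_fin]
    field_simp
  rw [Finset.prod_mul_distrib, Finset.prod_mul_distrib, ← Real.exp_sum, Finset.sum_neg_distrib,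
    ← Finset.mul_sum, sum_eq_mul_sampleMean hn, Real.finsetProd_rpow _ _ fun i _ => (hx i).le, h1,
    Real.mul_rpow (relProd_pos hn hx).le (by positivity)]
  simp
  ring

/-! ### Gamma laws give independence. -/

theorem map_eq_withDensity {Ω : Type*} [MeasurableSpace Ω] {μ : Measure Ω} [IsProbabilityMeasure μ]
    {n : ℕ} {F : Measure ℝ} [IsProbabilityMeasure F] {g : ℝ → ENNReal} (hg : Measurable g)
    (hF : F = volume.withDensity g) {X : Fin n → Ω → ℝ} (hX_meas : ∀ i, Measurable (X i))
    (hX_indep : iIndepFun X μ) (hX_law : ∀ i, μ.map (X i) = F) :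
    μ.map (fun ω i => X i ω) = volume.withDensity (fun x => ∏ i, g (x i)) := by
  rw [(iIndepFun_iff_map_fun_eq_pi_map fun i => (hX_meas i).aemeasurable).1 hX_indep]
  simp_rw [hX_law]
  subst hF
  exact pi_withDensity_eq hg

theorem indepFun_comp_iff {Ω E : Type*} [MeasurableSpace Ω] {μ : Measure Ω} [MeasurableSpace E]
    {Y : Ω → E} (hY : Measurable Y) {M R : E → ℝ} (hM : Measurable M) (hR : Measurable R) :
    IndepFun (fun ω => M (Y ω)) (fun ω => R (Y ω)) μ ↔ ∀ s t, MeasurableSet s → MeasurableSet t →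
      μ.map Y (M ⁻¹' s ∩ R ⁻¹' t) = μ.map Y (M ⁻¹' s) * μ.map Y (R ⁻¹' t) := by
  rw [indepFun_iff_measure_inter_preimage_eq_mul]
  refine forall_congr' fun s => forall_congr' fun t => forall_congr' fun hs =>
    forall_congr' fun ht => ?_
  rw [Measure.map_apply hY ((hM hs).inter (hR ht)), Measure.map_apply hY (hM hs),
    Measure.map_apply hY (hR ht)]
  rfl

theorem withDensity_radial_inter {n : ℕ} (hn : n ≠ 0) (a : Matrix (Fin n) (Fin n) ℝ) (b : ℝ)
    {φ : ℝ → ENNReal} (hφ : Measurable φ) {P : Measure (Fin n → ℝ)} [IsProbabilityMeasure P]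
    (hP : P = volume.withDensity fun x => ratioWeight a b Set.univ x * φ (sampleMean x))
    {s t : Set ℝ} (hs : MeasurableSet s) (ht : MeasurableSet t) :
    P (sampleMean ⁻¹' s ∩ ratioStat a ⁻¹' t)
      = P (sampleMean ⁻¹' s) * P (ratioStat a ⁻¹' t) := by
  have key : ∀ s t : Set ℝ, MeasurableSet s → MeasurableSet t →
      P (sampleMean ⁻¹' s ∩ ratioStat a ⁻¹' t)
        = ∫⁻ x, ratioWeight a b t x * s.indicator φ (sampleMean x) := by
    intro s t hs ht
    have hst : MeasurableSet (sampleMean ⁻¹' s ∩ ratioStat a ⁻¹' t) :=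
      (measurable_sampleMean hs).inter (measurable_ratioStat a ht)
    rw [hP, withDensity_apply _ hst, ← lintegral_indicator hst]
    congr 1 with x
    by_cases h1 : sampleMean x ∈ s <;> by_cases h2 : ratioStat a x ∈ t <;>
      simp [ratioWeight, Set.indicator, h1, h2]
  have h1 := key s Set.univ hs MeasurableSet.univ
  have h2 := key Set.univ t MeasurableSet.univ ht
  have h3 := key Set.univ Set.univ MeasurableSet.univ MeasurableSet.univ
  simp only [Set.preimage_univ, Set.inter_univ, Set.univ_inter, measure_univ,
    Set.indicator_univ] at h1 h2 h3
  -- The total mass `1` is inserted as a fourth integral, so that the cross identity applies.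
  rw [h1, h2, key s t hs ht, ← mul_one (∫⁻ x, ratioWeight a b t x * _), h3,
    lintegral_ratioWeight_cross hn a b b ht MeasurableSet.univ (hφ.indicator hs) hφ, mul_comm]

theorem gammaMeasure_eq_withDensity (b c : ℝ) :
    gammaMeasure b c = volume.withDensity fun x => ENNReal.ofReal
      (if 0 < x then c ^ b / Real.Gamma b * x ^ (b - 1) * Real.exp (-(c * x)) else 0) := by
  rw [gammaMeasure]
  apply withDensity_congr_ae
  -- The library density uses `0 ≤ x` instead of `0 < x`; the two can differ only at the null point
  -- `0`.
  have h0 : ∀ᵐ x : ℝ, x ≠ 0 := by simp [ae_iff]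
  filter_upwards [h0] with x hx
  rw [gammaPDF_eq]
  congr 1
  rcases lt_or_gt_of_ne hx with h | h
  · simp [h.not_ge, h.le.not_gt]
  · simp [h, h.le]

theorem indepFun_of_gammaMeasure {Ω : Type*} [MeasurableSpace Ω] {μ : Measure Ω}
    [IsProbabilityMeasure μ] {n : ℕ} (hn : n ≠ 0) {b c : ℝ} (hb : 0 < b) (hc : 0 < c)
    {X : Fin n → Ω → ℝ} (hX_meas : ∀ i, Measurable (X i))
    (hX_indep : iIndepFun X μ) (hX_law : ∀ i, μ.map (X i) = gammaMeasure b c)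
    (a : Matrix (Fin n) (Fin n) ℝ) :
    IndepFun (fun ω => sampleMean (fun i => X i ω)) (fun ω => ratioStat a (fun i => X i ω)) μ := by
  have := isProbabilityMeasure_gammaMeasure hb hc
  have hY : Measurable (fun ω i => X i ω) := measurable_pi_lambda _ hX_meas
  refine (indepFun_comp_iff hY measurable_sampleMean (measurable_ratioStat a)).2
    fun s t hs ht => ?_
  have := Measure.isProbabilityMeasure_map (μ := μ) hY.aemeasurable
  refine withDensity_radial_inter hn a (b - 1) (φ := fun m => ENNReal.ofReal
    ((c ^ b / Real.Gamma b) ^ n * (m ^ n) ^ (b - 1) * Real.exp (-(c * (n * m)))))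
    (by fun_prop) ?_ hs ht
  rw [map_eq_withDensity (Measurable.ennreal_ofReal (Measurable.ite measurableSet_Ioi (by fun_prop)
    measurable_const)) (gammaMeasure_eq_withDensity b c) hX_meas hX_indep hX_law]
  congr 1 with x
  by_cases hx : ∀ i, 0 < x i
  · have hC : 0 ≤ c ^ b / Real.Gamma b := div_nonneg (by positivity) (Real.Gamma_pos_of_pos hb).le
    simp only [hx, if_true]
    rw [ratioWeight_of_mem a _ hx (Set.mem_univ _), ← ENNReal.ofReal_mul (Real.rpow_nonneg (relProd_pos hn hx).le _),
      ← prod_gamma_kernel hn _ _ _ hx, ENNReal.ofReal_prod_of_nonneg]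
    intro i _
    have := hx i
    positivity
  · rw [ratioWeight_of_notMem a _ fun h => hx h.1, zero_mul]
    push Not at hx
    obtain ⟨i, hi⟩ := hx
    exact Finset.prod_eq_zero (Finset.mem_univ i) (by simp [hi.not_gt])

/-! ### Recognising a gamma density. -/

/-- Integrability at infinity forces `0 < c`, integrability at zero forces `-1 < b`, and total mass
one fixes `q`. -/
theorem isGammaDistribution_of_density {F : Measure ℝ} [IsProbabilityMeasure F] {f : ℝ → ℝ}
    (hf_zero : ∀ x ≤ 0, f x = 0) (hF : F = volume.withDensity fun x => ENNReal.ofReal (f x))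
    {q b c : ℝ} (hq : 0 < q)
    (hf : ∀ x, 0 < x → f x = q * x ^ b * Real.exp (-(c * x))) : IsGammaDistribution F := by
  have hint : IntegrableOn (fun x : ℝ => x ^ b * Real.exp (-(c * x))) (Set.Ioi 0) := by
    refine ⟨by fun_prop, ?_⟩
    have h1 : ∫⁻ x, ENNReal.ofReal (f x) = 1 := by
      have := measure_univ (μ := F)
      rwa [hF, withDensity_apply _ MeasurableSet.univ, Measure.restrict_univ] at this
    have h2 : ∫⁻ x in Set.Ioi (0 : ℝ), ENNReal.ofReal q * ‖x ^ b * Real.exp (-(c * x))‖ₑ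
        ≤ 1 := by
      rw [← h1]
      refine le_trans (le_of_eq ?_) (setLIntegral_le_lintegral (Set.Ioi (0 : ℝ)) _)
      refine setLIntegral_congr_fun measurableSet_Ioi fun x (hx : 0 < x) => ?_
      rw [Real.enorm_of_nonneg (by positivity), ← ENNReal.ofReal_mul hq.le, hf x hx, mul_assoc]
    rw [lintegral_const_mul _ (by fun_prop)] at h2
    rw [HasFiniteIntegral]
    by_contra h
    rw [not_lt, top_le_iff] at h
    rw [h, ENNReal.mul_top (by simpa using hq)] at h2
    simp at h2
  have hcpos : 0 < c := by
    by_contra hc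
    refine not_integrableOn_Ioi_rpow b (hint.mono' (by fun_prop) ?_)
    refine (ae_restrict_iff' measurableSet_Ioi).2 (ae_of_all _ fun x (hx : 0 < x) => ?_)
    rw [Real.norm_of_nonneg (by positivity)]
    refine le_mul_of_one_le_right (by positivity) (Real.one_le_exp ?_)
    nlinarith
  have hbpos : 0 < b + 1 := by
    have h1 : IntegrableOn (fun x : ℝ => x ^ b) (Set.Ioo 0 1) := by
      have h2 : IntegrableOn (fun x : ℝ => Real.exp c * (x ^ b * Real.exp (-(c * x))))
        (Set.Ioo 0 1) := (hint.mono_set Set.Ioo_subset_Ioi_self).const_mul _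
      refine h2.mono' (by fun_prop) ?_
      refine (ae_restrict_iff' measurableSet_Ioo).2 (ae_of_all _ fun x hx => ?_)
      have := hx.1
      rw [Real.norm_of_nonneg (by positivity), mul_left_comm, ← Real.exp_add]
      refine le_mul_of_one_le_right (by positivity) (Real.one_le_exp ?_)
      nlinarith [hx.2]
    have := (intervalIntegral.integrableOn_Ioo_rpow_iff one_pos).1 h1
    linarith
  have := isProbabilityMeasure_gammaMeasure hbpos hcpos
  refine ⟨b + 1, 1 / c, hbpos, by positivity, ?_⟩
  rw [one_div_one_div]
  set C := c ^ (b + 1) / Real.Gamma (b + 1)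
  have hC : 0 < C := div_pos (by positivity) (Real.Gamma_pos_of_pos hbpos)
  have hsmul : F = ENNReal.ofReal (q / C) • gammaMeasure (b + 1) c := by
    rw [gammaMeasure_eq_withDensity, ← withDensity_smul' _ _ ENNReal.ofReal_ne_top, hF]
    congr 1 with x
    rw [Pi.smul_apply, smul_eq_mul, ← ENNReal.ofReal_mul (by positivity)]
    congr 1
    split_ifs with hx
    · rw [hf x hx, add_sub_cancel_right]
      change _ = q / C * (C * _ * _)
      field_simp
    · rw [hf_zero x (not_lt.1 hx), mul_zero]
  have h1 : ENNReal.ofReal (q / C) = 1 := by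
    have := congrArg (fun ν : Measure ℝ => ν Set.univ) hsmul
    simpa using this.symm
  rw [hsmul, h1, one_smul]

/-! ### Localisation near constant vectors. -/

theorem exists_nhds_const_of_eventually {n : ℕ} {a : Matrix (Fin n) (Fin n) ℝ}
    (ha : ∀ v : Fin n → ℝ, v ≠ 0 → 0 < ∑ i, ∑ j, a i j * v i * v j) {m₀ : ℝ} (hm₀ : 0 < m₀)
    {Q : (Fin n → ℝ) → Prop} (hQ : ∀ᶠ x in nhds (fun _ => m₀), Q x) :
    ∃ ρ > 0, ∃ δ > 0, ∀ x, sampleMean x ∈ Metric.ball m₀ ρ → ratioStat a x ≤ δ → Q x := by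
  obtain ⟨K, hK, h⟩ := exists_abs_sub_sampleMean_le ha
  obtain ⟨η, hη, hQ⟩ := Metric.eventually_nhds_iff.1 hQ
  -- The mean stays below `2 * m₀`, so the spread about it is at most `K * (η / (4 * K * m₀)) * (2 *
  -- m₀) = η / 2`; the other `η / 2` allows for the distance from the mean to `m₀`.
  refine ⟨min (η / 2) m₀, by positivity, η / (4 * K * m₀), by positivity, fun x hx hR => hQ ?_⟩
  rw [Metric.mem_ball, Real.dist_eq, lt_min_iff] at hx
  obtain ⟨h1, h2⟩ := hx
  have hm : 0 < sampleMean x := by linarith [(abs_lt.1 h2).1]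
  have hm2 : sampleMean x < 2 * m₀ := by linarith [(abs_lt.1 h2).2]
  rw [dist_pi_lt_iff hη]
  intro i
  rw [Real.dist_eq]
  have h3 : |x i - sampleMean x| ≤ η / 2 := by
    refine (h x hm i).trans ?_
    calc K * ratioStat a x * sampleMean x ≤ K * (η / (4 * K * m₀)) * (2 * m₀) := by gcongr
      _ = η / 2 := by field_simp; norm_num
  calc |x i - m₀| ≤ |x i - sampleMean x| + |sampleMean x - m₀| := abs_sub_le _ _ _
    _ < η := by linarith

/-- The total mass of `ratioWeight a b (Iic ε)` over the vectors with sample mean in `(1, 2)`. -/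
noncomputable def ratioMass {n : ℕ} (a : Matrix (Fin n) (Fin n) ℝ) (b ε : ℝ) : ENNReal :=
  ∫⁻ x, ratioWeight a b (Set.Iic ε) x * (Set.Ioo (1 : ℝ) 2).indicator 1 (sampleMean x)

theorem measurable_bump : Measurable ((Set.Ioo (1 : ℝ) 2).indicator (1 : ℝ → ENNReal)) :=
  measurable_one.indicator measurableSet_Ioo

theorem ratioMass_zero_ne_top {n : ℕ} (hn : n ≠ 0) (a : Matrix (Fin n) (Fin n) ℝ) (ε : ℝ) :
    ratioMass a 0 ε ≠ ⊤ := by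
  have hs : MeasurableSet (Set.univ.pi fun _ : Fin n => Set.Icc (0 : ℝ) (n * 2)) :=
    MeasurableSet.univ_pi fun _ => measurableSet_Icc
  have hfin : ∫⁻ x, (Set.univ.pi fun _ : Fin n => Set.Icc (0 : ℝ) (n * 2)).indicator 1 x
      ≠ ⊤ := by
    rw [lintegral_indicator_one hs, volume_pi, Measure.pi_pi]
    exact ENNReal.prod_ne_top fun i _ => by
      rw [Real.volume_Icc]
      exact ENNReal.ofReal_ne_top
  refine ne_top_of_le_ne_top hfin (lintegral_mono fun x => ?_)
  by_cases hx : (∀ i, 0 < x i) ∧ sampleMean x ∈ Set.Ioo 1 2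
  · have hmem : x ∈ Set.univ.pi fun _ : Fin n => Set.Icc (0 : ℝ) (n * 2) := by
      intro i _
      refine ⟨(hx.1 i).le, ?_⟩
      calc x i ≤ ∑ j, x j :=
            Finset.single_le_sum (fun j _ => (hx.1 j).le) (Finset.mem_univ i)
        _ = n * sampleMean x := sum_eq_mul_sampleMean hn x
        _ ≤ n * 2 := by gcongr; exact hx.2.2.le
    rw [Set.indicator_of_mem hx.2, Set.indicator_of_mem hmem, Pi.one_apply, mul_one]
    refine (Set.indicator_le_self _ _ _).trans (by simp)
  · rw [not_and_or] at hx
    rcases hx with hx | hx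
    · rw [ratioWeight_of_notMem a _ fun h => hx h.1, zero_mul]
      exact zero_le
    · rw [Set.indicator_of_notMem hx, mul_zero]
      exact zero_le

theorem ratioMass_lt_of_lt {n : ℕ} (hn : 2 ≤ n) (a : Matrix (Fin n) (Fin n) ℝ) {b b' ε : ℝ}
    (hε : 0 < ε) (hb : b' < b) (hfin : ratioMass a b' ε ≠ ⊤) :
    ratioMass a b ε < ratioMass a b' ε := by
  have hn0 : n ≠ 0 := by omega
  obtain ⟨O, hO, hOne, hOp⟩ := exists_isOpen_nonconst hn a hε
  have hle : ∀ x, ratioWeight a b (Set.Iic ε) x * (Set.Ioo (1 : ℝ) 2).indicator 1 (sampleMean x)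
      ≤ ratioWeight a b' (Set.Iic ε) x * (Set.Ioo (1 : ℝ) 2).indicator 1 (sampleMean x) := by
    intro x
    gcongr
    refine Set.indicator_le_indicator' fun hx => ENNReal.ofReal_le_ofReal ?_
    exact Real.rpow_le_rpow_of_exponent_ge (relProd_pos hn0 hx.1) (relProd_le_one hn0 hx.1) hb.le
  refine lintegral_strict_mono_of_ae_le_of_ae_lt_on (s := O) ?_ ?_ (ae_of_all _ hle)
    (hO.measure_pos volume hOne).ne' (ae_of_all _ fun x hx => ?_)
  · exact ((measurable_ratioWeight a b' measurableSet_Iic).mul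
      (measurable_bump.comp measurable_sampleMean)).aemeasurable
  · exact ne_top_of_le_ne_top hfin (lintegral_mono hle)
  · obtain ⟨h1, h2, h3, k, l, hkl⟩ := hOp x hx
    rw [Set.indicator_of_mem h3, ratioWeight_of_mem a _ h1 (Set.mem_Iic.2 h2),
      ratioWeight_of_mem a _ h1 (Set.mem_Iic.2 h2), Pi.one_apply, mul_one, mul_one]
    have hp := relProd_pos hn0 h1
    exact (ENNReal.ofReal_lt_ofReal_iff (Real.rpow_pos_of_pos hp _)).2
      (Real.rpow_lt_rpow_of_exponent_gt hp (relProd_lt_one hn0 h1 hkl) hb)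

/-! ### Comparison of small-ratio probabilities with weighted masses. -/

section Density

variable {n : ℕ} {a : Matrix (Fin n) (Fin n) ℝ} {P : Measure (Fin n → ℝ)}
  {p : (Fin n → ℝ) → ENNReal}

theorem withDensity_inter_eq (hP : P = volume.withDensity p)
    {s t : Set ℝ} (hs : MeasurableSet s) (ht : MeasurableSet t) :
    P (sampleMean ⁻¹' s ∩ ratioStat a ⁻¹' t)
      = ∫⁻ x, (sampleMean ⁻¹' s ∩ ratioStat a ⁻¹' t).indicator p x := by
  have hst : MeasurableSet (sampleMean ⁻¹' s ∩ ratioStat a ⁻¹' t) :=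
    (measurable_sampleMean hs).inter (measurable_ratioStat a ht)
  rw [hP, withDensity_apply _ hst, ← lintegral_indicator hst]

theorem withDensity_inter_le (hP : P = volume.withDensity p)
    (hp0 : ∀ x, (¬ ∀ i, 0 < x i) → p x = 0) {s t : Set ℝ} (hs : MeasurableSet s)
    (ht : MeasurableSet t) {b : ℝ} {h : ℝ → ENNReal}
    (hle : ∀ x, (∀ i, 0 < x i) → sampleMean x ∈ s → ratioStat a x ∈ t →
      p x ≤ ENNReal.ofReal (relProd x ^ b) * h (sampleMean x)) :
    P (sampleMean ⁻¹' s ∩ ratioStat a ⁻¹' t)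
      ≤ ∫⁻ x, ratioWeight a b t x * s.indicator h (sampleMean x) := by
  rw [withDensity_inter_eq hP hs ht]
  refine lintegral_mono fun x => ?_
  by_cases hx : x ∈ sampleMean ⁻¹' s ∩ ratioStat a ⁻¹' t
  · rw [Set.indicator_of_mem hx, Set.indicator_of_mem (show sampleMean x ∈ s from hx.1)]
    by_cases hx0 : ∀ i, 0 < x i
    · rw [ratioWeight_of_mem (t := t) a b hx0 hx.2]
      exact hle x hx0 hx.1 hx.2
    · rw [hp0 x hx0]
      exact zero_le
  · rw [Set.indicator_of_notMem hx]
    exact zero_le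

theorem le_withDensity_inter (hP : P = volume.withDensity p)
    {s t : Set ℝ} (hs : MeasurableSet s)
    (ht : MeasurableSet t) {b : ℝ} {h : ℝ → ENNReal}
    (hle : ∀ x, (∀ i, 0 < x i) → sampleMean x ∈ s → ratioStat a x ∈ t →
      ENNReal.ofReal (relProd x ^ b) * h (sampleMean x) ≤ p x) :
    ∫⁻ x, ratioWeight a b t x * s.indicator h (sampleMean x)
      ≤ P (sampleMean ⁻¹' s ∩ ratioStat a ⁻¹' t) := by
  rw [withDensity_inter_eq hP hs ht]
  refine lintegral_mono fun x => ?_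
  by_cases hx0 : (∀ i, 0 < x i) ∧ ratioStat a x ∈ t
  · by_cases hxs : sampleMean x ∈ s
    · have hx : x ∈ sampleMean ⁻¹' s ∩ ratioStat a ⁻¹' t := ⟨hxs, hx0.2⟩
      rw [Set.indicator_of_mem hxs, Set.indicator_of_mem hx, ratioWeight_of_mem a b hx0.1 hx0.2]
      exact hle x hx0.1 hxs hx0.2
    · rw [Set.indicator_of_notMem hxs, mul_zero]
      exact zero_le
  · rw [ratioWeight_of_notMem a b hx0, zero_mul]
    exact zero_le

/-- By independence both ratio events carry the factor `P (sampleMean ⁻¹' s)`, which cancels. The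
cross identity then trades the unknown radial function `h` for the fixed bump in `ratioMass`, which
makes bounds obtained at different points comparable. -/
theorem measure_mul_ratioMass_le [IsProbabilityMeasure P] (hn : n ≠ 0) (hP : P = volume.withDensity p)
    (hp0 : ∀ x, (¬ ∀ i, 0 < x i) → p x = 0)
    (hind : ∀ s t, MeasurableSet s → MeasurableSet t →
      P (sampleMean ⁻¹' s ∩ ratioStat a ⁻¹' t) = P (sampleMean ⁻¹' s) * P (ratioStat a ⁻¹' t))
    {s : Set ℝ} (hs : MeasurableSet s) (hs0 : P (sampleMean ⁻¹' s) ≠ 0) {b ε δ : ℝ}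
    {h : ℝ → ENNReal} (hh : Measurable h) {k : ENNReal} (hk : k ≠ 0) (hk' : k ≠ ⊤)
    (hE : ∀ x, (∀ i, 0 < x i) → sampleMean x ∈ s → ratioStat a x ≤ ε →
      p x ≤ ENNReal.ofReal (relProd x ^ b) * h (sampleMean x))
    (hD : ∀ x, (∀ i, 0 < x i) → sampleMean x ∈ s → ratioStat a x ≤ δ →
      h (sampleMean x) ≤ k * p x) :
    P (ratioStat a ⁻¹' Set.Iic ε) * ratioMass a 0 δ
      ≤ k * ratioMass a b ε * P (ratioStat a ⁻¹' Set.Iic δ) := by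
  have h1 := withDensity_inter_le hP hp0 hs (measurableSet_Iic (a := ε)) hE
  have h2 := le_withDensity_inter (a := a) (b := 0) (h := fun m => k⁻¹ * h m) hP hs
    (measurableSet_Iic (a := δ)) fun x hx hxs hxδ => by
      rw [Real.rpow_zero, ENNReal.ofReal_one, one_mul, ENNReal.inv_mul_le_iff hk hk']
      exact hD x hx hxs hxδ
  have h3 : ∫⁻ x, ratioWeight a 0 (Set.Iic δ) x * s.indicator (fun m => k⁻¹ * h m) (sampleMean x)
      = k⁻¹ * ∫⁻ x, ratioWeight a 0 (Set.Iic δ) x * s.indicator h (sampleMean x) := by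
    rw [← lintegral_const_mul]
    · congr 1 with x
      by_cases hx : sampleMean x ∈ s <;> simp [hx, mul_left_comm]
    · exact (measurable_ratioWeight a 0 measurableSet_Iic).mul
        ((hh.indicator hs).comp measurable_sampleMean)
  rw [h3, ENNReal.inv_mul_le_iff hk hk', hind _ _ hs measurableSet_Iic] at h2
  rw [hind _ _ hs measurableSet_Iic] at h1
  have h4 := lintegral_ratioWeight_cross hn a b 0 (measurableSet_Iic (a := ε))
    (measurableSet_Iic (a := δ)) (hh.indicator hs) measurable_bump
  rw [← ENNReal.mul_le_mul_iff_right hs0 (measure_ne_top P _)]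
  calc P (sampleMean ⁻¹' s) * (P (ratioStat a ⁻¹' Set.Iic ε) * ratioMass a 0 δ)
      = (P (sampleMean ⁻¹' s) * P (ratioStat a ⁻¹' Set.Iic ε)) * ratioMass a 0 δ := by ring
    _ ≤ _ := mul_le_mul_left h1 _
    _ = _ := h4
    _ ≤ _ := mul_le_mul_right h2 _
    _ = _ := by rw [← ratioMass]; ring

/-- The mirror image of `measure_mul_ratioMass_le`, with both density bounds reversed. -/
theorem ratioMass_mul_measure_le [IsProbabilityMeasure P] (hn : n ≠ 0) (hP : P = volume.withDensity p)
    (hp0 : ∀ x, (¬ ∀ i, 0 < x i) → p x = 0)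
    (hind : ∀ s t, MeasurableSet s → MeasurableSet t →
      P (sampleMean ⁻¹' s ∩ ratioStat a ⁻¹' t) = P (sampleMean ⁻¹' s) * P (ratioStat a ⁻¹' t))
    {s : Set ℝ} (hs : MeasurableSet s) (hs0 : P (sampleMean ⁻¹' s) ≠ 0) {b ε δ : ℝ}
    {h : ℝ → ENNReal} (hh : Measurable h) {k : ENNReal}
    (hE : ∀ x, (∀ i, 0 < x i) → sampleMean x ∈ s → ratioStat a x ≤ ε →
      ENNReal.ofReal (relProd x ^ b) * h (sampleMean x) ≤ p x)
    (hD : ∀ x, (∀ i, 0 < x i) → sampleMean x ∈ s → ratioStat a x ≤ δ →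
      p x ≤ k * h (sampleMean x)) :
    ratioMass a b ε * P (ratioStat a ⁻¹' Set.Iic δ)
      ≤ k * (P (ratioStat a ⁻¹' Set.Iic ε) * ratioMass a 0 δ) := by
  have h1 := le_withDensity_inter hP hs (measurableSet_Iic (a := ε)) hE
  have h2 := withDensity_inter_le (a := a) (b := 0) (h := fun m => k * h m) hP hp0 hs
    (measurableSet_Iic (a := δ)) fun x hx hxs hxδ => by
      rw [Real.rpow_zero, ENNReal.ofReal_one, one_mul]
      exact hD x hx hxs hxδ
  have h3 : ∫⁻ x, ratioWeight a 0 (Set.Iic δ) x * s.indicator (fun m => k * h m) (sampleMean x)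
      = k * ∫⁻ x, ratioWeight a 0 (Set.Iic δ) x * s.indicator h (sampleMean x) := by
    rw [← lintegral_const_mul]
    · congr 1 with x
      by_cases hx : sampleMean x ∈ s <;> simp [hx, mul_left_comm]
    · exact (measurable_ratioWeight a 0 measurableSet_Iic).mul
        ((hh.indicator hs).comp measurable_sampleMean)
  rw [h3, hind _ _ hs measurableSet_Iic] at h2
  rw [hind _ _ hs measurableSet_Iic] at h1
  have h4 := lintegral_ratioWeight_cross hn a b 0 (measurableSet_Iic (a := ε))
    (measurableSet_Iic (a := δ)) (hh.indicator hs) measurable_bump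
  rw [← ENNReal.mul_le_mul_iff_right hs0 (measure_ne_top P _)]
  calc P (sampleMean ⁻¹' s) * (ratioMass a b ε * P (ratioStat a ⁻¹' Set.Iic δ))
      = ratioMass a b ε * (P (sampleMean ⁻¹' s) * P (ratioStat a ⁻¹' Set.Iic δ)) := by ring
    _ ≤ _ := mul_le_mul_right h2 _
    _ = k * (ratioMass a b ε *
          ∫⁻ x, ratioWeight a 0 (Set.Iic δ) x * s.indicator h (sampleMean x)) := by ring
    _ = _ := congrArg (k * ·) h4.symm
    _ ≤ k * ((P (sampleMean ⁻¹' s) * P (ratioStat a ⁻¹' Set.Iic ε)) * ratioMass a 0 δ) :=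
        mul_le_mul_right (mul_le_mul_left h1 _) _
    _ = _ := by ring

end Density

/-! ### Kernels touching the density. -/

theorem sampleMean_const {n : ℕ} (hn : n ≠ 0) (m : ℝ) : sampleMean (fun _ : Fin n => m) = m := by
  have : (n : ℝ) ≠ 0 := by exact_mod_cast hn
  simp [sampleMean]
  field_simp

theorem relProd_const {n : ℕ} (hn : n ≠ 0) {m : ℝ} (hm : m ≠ 0) :
    relProd (fun _ : Fin n => m) = 1 := by
  simp [relProd, sampleMean_const hn, hm]

section Touching

variable {n : ℕ} {f : ℝ → ℝ} {q b c m₀ : ℝ}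

/-- If the gamma kernel `q x ^ b exp (-c x)` agrees with `f` at `m₀`, then near the constant
vector `m₀` the radial part of its `n`-fold product is comparable to the `n`-fold product of `f`,
with constants arbitrarily close to `1`. -/
theorem eventually_radial_comparable (hn : n ≠ 0) (hf_pos : ∀ x, 0 < x → 0 < f x)
    (hf_cont : ContinuousOn f (Set.Ioi 0)) (hm₀ : 0 < m₀)
    (heq : f m₀ = q * m₀ ^ b * Real.exp (-(c * m₀))) {k : ℝ} (hk : 1 < k) :
    ∀ᶠ x in nhds (fun _ : Fin n => m₀),
      q ^ n * (sampleMean x ^ n) ^ b * Real.exp (-(c * (n * sampleMean x))) ≤ k * ∏ i, f (x i) ∧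
      ∏ i, f (x i) ≤
        k * (q ^ n * (sampleMean x ^ n) ^ b * Real.exp (-(c * (n * sampleMean x)))) := by
  set x₀ : Fin n → ℝ := fun _ => m₀ with hx₀
  have hmx : sampleMean x₀ = m₀ := sampleMean_const hn m₀
  set H : (Fin n → ℝ) → ℝ := fun x =>
    q ^ n * (sampleMean x ^ n) ^ b * Real.exp (-(c * (n * sampleMean x))) with hH
  have hval : H x₀ = ∏ i, f (x₀ i) := by
    have := prod_gamma_kernel hn q b c (x := x₀) (fun _ => hm₀)
    rw [relProd_const hn hm₀.ne', Real.one_rpow, one_mul] at this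
    rw [hH]
    beta_reduce
    rw [← this]
    exact Finset.prod_congr rfl fun i _ => heq.symm
  have hpos : 0 < ∏ i, f (x₀ i) := Finset.prod_pos fun i _ => hf_pos _ hm₀
  have hc1 : ContinuousAt H x₀ := by
    refine ContinuousAt.mul (ContinuousAt.mul continuousAt_const ?_) (by fun_prop)
    exact ContinuousAt.rpow_const (by fun_prop) (Or.inl (by rw [hmx]; positivity))
  have hc2 : ContinuousAt (fun x : Fin n → ℝ => ∏ i, f (x i)) x₀ := by
    refine tendsto_finsetProd _ fun i _ => ?_
    exact ContinuousAt.comp (f := fun x : Fin n → ℝ => x i) (g := f)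
      (hf_cont.continuousAt (Ioi_mem_nhds hm₀)) (continuous_apply i).continuousAt
  have h1 := hc1.eventually_lt (hc2.const_mul k) (by
    simp only [hval]
    nlinarith)
  have h2 := hc2.eventually_lt (hc1.const_mul k) (by
    simp only [hval]
    nlinarith)
  filter_upwards [h1, h2] with x hx1 hx2
  exact ⟨hx1.le, hx2.le⟩

theorem eventually_nhds_const {Q : ℝ → Prop} (hQ : ∀ᶠ y in nhds m₀, Q y) :
    ∀ᶠ x in nhds (fun _ : Fin n => m₀), ∀ i, Q (x i) :=
  Filter.eventually_all.2 fun i =>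
    (continuous_apply (A := fun _ : Fin n => ℝ) i).continuousAt.eventually hQ

theorem measure_ne_zero_of_isOpen {P : Measure (Fin n → ℝ)} (hf_pos : ∀ x, 0 < x → 0 < f x)
    (hfm : Measurable f)
    (hP : P = volume.withDensity fun x => ∏ i, ENNReal.ofReal (f (x i)))
    {O A : Set (Fin n → ℝ)} (hO : IsOpen O) (hOne : O.Nonempty) (hpos : ∀ x ∈ O, ∀ i, 0 < x i)
    (hOA : O ⊆ A) : P A ≠ 0 := by
  refine fun h0 => ?_
  have h1 : P O = 0 := measure_mono_null hOA h0
  rw [hP, withDensity_apply_eq_zero (by fun_prop)] at h1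
  have h2 : {x : Fin n → ℝ | ∏ i, ENNReal.ofReal (f (x i)) ≠ 0} ∩ O = O := by
    refine Set.inter_eq_right.2 fun x hx => ?_
    exact Finset.prod_ne_zero_iff.2 fun i _ => by
      simpa using hf_pos _ (hpos x hx i)
  rw [h2] at h1
  exact (hO.measure_pos volume hOne).ne' h1

theorem measure_sampleMean_ball_ne_zero (hn : n ≠ 0) {P : Measure (Fin n → ℝ)}
    (hf_pos : ∀ x, 0 < x → 0 < f x) (hfm : Measurable f)
    (hP : P = volume.withDensity fun x => ∏ i, ENNReal.ofReal (f (x i))) (hm₀ : 0 < m₀)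
    {ρ : ℝ} (hρ : 0 < ρ) : P (sampleMean ⁻¹' Metric.ball m₀ ρ) ≠ 0 := by
  refine measure_ne_zero_of_isOpen hf_pos hfm hP
    (O := (sampleMean ⁻¹' Metric.ball m₀ ρ) ∩ Set.univ.pi fun _ => Set.Ioi 0)
    ((Metric.isOpen_ball.preimage continuous_sampleMean).inter
      (isOpen_set_pi Set.finite_univ fun _ _ => isOpen_Ioi))
    ⟨fun _ => m₀, ?_, fun _ _ => hm₀⟩ (fun x hx i => hx.2 i trivial) Set.inter_subset_left
  rw [Set.mem_preimage, sampleMean_const hn]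
  exact Metric.mem_ball_self hρ

theorem prod_ofReal_eq_zero (hf_zero : ∀ x ≤ 0, f x = 0) (x : Fin n → ℝ)
    (hx : ¬ ∀ i, 0 < x i) : ∏ i, ENNReal.ofReal (f (x i)) = 0 := by
  push Not at hx
  obtain ⟨i, hi⟩ := hx
  exact Finset.prod_eq_zero (Finset.mem_univ i) (by rw [hf_zero _ hi, ENNReal.ofReal_zero])

variable {a : Matrix (Fin n) (Fin n) ℝ} {P : Measure (Fin n → ℝ)}
  [IsProbabilityMeasure P]

theorem exists_measure_mul_ratioMass_le (hn : n ≠ 0)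
    (ha : ∀ v : Fin n → ℝ, v ≠ 0 → 0 < ∑ i, ∑ j, a i j * v i * v j)
    (hf_zero : ∀ x ≤ 0, f x = 0) (hf_pos : ∀ x, 0 < x → 0 < f x)
    (hf_cont : ContinuousOn f (Set.Ioi 0)) (hfm : Measurable f)
    (hP : P = volume.withDensity fun x => ∏ i, ENNReal.ofReal (f (x i)))
    (hind : ∀ s t, MeasurableSet s → MeasurableSet t →
      P (sampleMean ⁻¹' s ∩ ratioStat a ⁻¹' t) = P (sampleMean ⁻¹' s) * P (ratioStat a ⁻¹' t))
    (hm₀ : 0 < m₀) (heq : f m₀ = q * m₀ ^ b * Real.exp (-(c * m₀)))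
    (hle : ∀ᶠ y in nhds m₀, f y ≤ q * y ^ b * Real.exp (-(c * y))) :
    ∃ ε₀ > 0, ∀ ε ≤ ε₀, ∀ k : ℝ, 1 < k → ∃ δ₀ > 0, ∀ δ ≤ δ₀,
      P (ratioStat a ⁻¹' Set.Iic ε) * ratioMass a 0 δ
        ≤ ENNReal.ofReal k * ratioMass a b ε * P (ratioStat a ⁻¹' Set.Iic δ) := by
  obtain ⟨ρ₁, hρ₁, ε₀, hε₀, h1⟩ := exists_nhds_const_of_eventually ha hm₀
    (eventually_nhds_const hle)
  refine ⟨ε₀, hε₀, fun ε hε k hk => ?_⟩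
  obtain ⟨ρ₂, hρ₂, δ₀, hδ₀, h2⟩ := exists_nhds_const_of_eventually ha hm₀
    (eventually_radial_comparable hn hf_pos hf_cont hm₀ heq hk)
  refine ⟨δ₀, hδ₀, fun δ hδ => measure_mul_ratioMass_le hn hP (prod_ofReal_eq_zero hf_zero) hind
    (s := Metric.ball m₀ (min ρ₁ ρ₂)) Metric.isOpen_ball.measurableSet
    (measure_sampleMean_ball_ne_zero hn hf_pos hfm hP hm₀ (lt_min hρ₁ hρ₂))
    (h := fun m => ENNReal.ofReal (q ^ n * (m ^ n) ^ b * Real.exp (-(c * (n * m)))))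
    (by fun_prop) (by simp; linarith) ENNReal.ofReal_ne_top ?_ ?_⟩
  · intro x hx hxs hxε
    have h3 := h1 x (Metric.ball_subset_ball (min_le_left _ _) hxs) (hxε.trans hε)
    rw [← ENNReal.ofReal_mul (Real.rpow_nonneg (relProd_pos hn hx).le _),
      ← prod_gamma_kernel hn q b c hx,
      ← ENNReal.ofReal_prod_of_nonneg fun i _ => (hf_pos _ (hx i)).le]
    exact ENNReal.ofReal_le_ofReal
      (Finset.prod_le_prod (fun i _ => (hf_pos _ (hx i)).le) fun i _ => h3 i)
  · intro x hx hxs hxδ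
    have h3 := h2 x (Metric.ball_subset_ball (min_le_right _ _) hxs) (hxδ.trans hδ)
    rw [← ENNReal.ofReal_prod_of_nonneg fun i _ => (hf_pos _ (hx i)).le,
      ← ENNReal.ofReal_mul (by linarith)]
    exact ENNReal.ofReal_le_ofReal h3.1

theorem exists_ratioMass_mul_measure_le (hn : n ≠ 0)
    (ha : ∀ v : Fin n → ℝ, v ≠ 0 → 0 < ∑ i, ∑ j, a i j * v i * v j)
    (hf_zero : ∀ x ≤ 0, f x = 0) (hf_pos : ∀ x, 0 < x → 0 < f x)
    (hf_cont : ContinuousOn f (Set.Ioi 0)) (hfm : Measurable f)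
    (hP : P = volume.withDensity fun x => ∏ i, ENNReal.ofReal (f (x i)))
    (hind : ∀ s t, MeasurableSet s → MeasurableSet t →
      P (sampleMean ⁻¹' s ∩ ratioStat a ⁻¹' t) = P (sampleMean ⁻¹' s) * P (ratioStat a ⁻¹' t))
    (hm₀ : 0 < m₀) (hq : 0 < q) (heq : f m₀ = q * m₀ ^ b * Real.exp (-(c * m₀)))
    (hle : ∀ᶠ y in nhds m₀, q * y ^ b * Real.exp (-(c * y)) ≤ f y) :
    ∃ ε₀ > 0, ∀ ε ≤ ε₀, ∀ k : ℝ, 1 < k → ∃ δ₀ > 0, ∀ δ ≤ δ₀,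
      ratioMass a b ε * P (ratioStat a ⁻¹' Set.Iic δ)
        ≤ ENNReal.ofReal k * (P (ratioStat a ⁻¹' Set.Iic ε) * ratioMass a 0 δ) := by
  obtain ⟨ρ₁, hρ₁, ε₀, hε₀, h1⟩ := exists_nhds_const_of_eventually ha hm₀
    (eventually_nhds_const hle)
  refine ⟨ε₀, hε₀, fun ε hε k hk => ?_⟩
  obtain ⟨ρ₂, hρ₂, δ₀, hδ₀, h2⟩ := exists_nhds_const_of_eventually ha hm₀
    (eventually_radial_comparable hn hf_pos hf_cont hm₀ heq hk)
  refine ⟨δ₀, hδ₀, fun δ hδ => ratioMass_mul_measure_le hn hP (prod_ofReal_eq_zero hf_zero) hind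
    (s := Metric.ball m₀ (min ρ₁ ρ₂)) Metric.isOpen_ball.measurableSet
    (measure_sampleMean_ball_ne_zero hn hf_pos hfm hP hm₀ (lt_min hρ₁ hρ₂))
    (h := fun m => ENNReal.ofReal (q ^ n * (m ^ n) ^ b * Real.exp (-(c * (n * m)))))
    (by fun_prop) ?_ ?_⟩
  · intro x hx hxs hxε
    have h3 := h1 x (Metric.ball_subset_ball (min_le_left _ _) hxs) (hxε.trans hε)
    rw [← ENNReal.ofReal_mul (Real.rpow_nonneg (relProd_pos hn hx).le _),
      ← prod_gamma_kernel hn q b c hx,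
      ← ENNReal.ofReal_prod_of_nonneg fun i _ => (hf_pos _ (hx i)).le]
    refine ENNReal.ofReal_le_ofReal (Finset.prod_le_prod (fun i _ => ?_) fun i _ => h3 i)
    have := hx i
    positivity
  · intro x hx hxs hxδ
    have h3 := h2 x (Metric.ball_subset_ball (min_le_right _ _) hxs) (hxδ.trans hδ)
    rw [← ENNReal.ofReal_prod_of_nonneg fun i _ => (hf_pos _ (hx i)).le,
      ← ENNReal.ofReal_mul (by linarith)]
    exact ENNReal.ofReal_le_ofReal h3.2

/-- The two touching bounds are multiplied at a common `ε` and `δ`. The quantities depending on `δ`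
cancel, leaving a comparison of `ratioMass` at the two exponents. -/
theorem exponent_le_of_touching (hn : 2 ≤ n)
    (ha : ∀ v : Fin n → ℝ, v ≠ 0 → 0 < ∑ i, ∑ j, a i j * v i * v j)
    (hf_zero : ∀ x ≤ 0, f x = 0) (hf_pos : ∀ x, 0 < x → 0 < f x)
    (hf_cont : ContinuousOn f (Set.Ioi 0)) (hfm : Measurable f)
    (hP : P = volume.withDensity fun x => ∏ i, ENNReal.ofReal (f (x i)))
    (hind : ∀ s t, MeasurableSet s → MeasurableSet t →
      P (sampleMean ⁻¹' s ∩ ratioStat a ⁻¹' t) = P (sampleMean ⁻¹' s) * P (ratioStat a ⁻¹' t))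
    (hm₀ : 0 < m₀) (heq : f m₀ = q * m₀ ^ b * Real.exp (-(c * m₀)))
    (hle : ∀ᶠ y in nhds m₀, f y ≤ q * y ^ b * Real.exp (-(c * y)))
    {m₁ q' b' c' : ℝ} (hm₁ : 0 < m₁) (hq' : 0 < q')
    (heq' : f m₁ = q' * m₁ ^ b' * Real.exp (-(c' * m₁)))
    (hle' : ∀ᶠ y in nhds m₁, q' * y ^ b' * Real.exp (-(c' * y)) ≤ f y) : b ≤ b' := by
  have hn0 : n ≠ 0 := by omega
  obtain ⟨ε₁, hε₁, h1⟩ := exists_measure_mul_ratioMass_le hn0 ha hf_zero hf_pos hf_cont hfm hP hind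
    hm₀ heq hle
  obtain ⟨ε₂, hε₂, h2⟩ := exists_ratioMass_mul_measure_le hn0 ha hf_zero hf_pos hf_cont hfm hP hind
    hm₁ hq' heq' hle'
  set ε := min ε₁ ε₂
  have hε : 0 < ε := lt_min hε₁ hε₂
  have hne : ∀ δ > 0, P (ratioStat a ⁻¹' Set.Iic δ) ≠ 0 := by
    intro δ hδ
    obtain ⟨O, hO, hOne, hOp⟩ := exists_isOpen_nonconst hn a hδ
    exact measure_ne_zero_of_isOpen hf_pos hfm hP hO hOne (fun x hx => (hOp x hx).1)
      fun x hx => (hOp x hx).2.1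
  -- For negative `b'` the weight can exceed `1`, so finiteness is read off the lower touching bound
  -- (with `k = 2`), whose right-hand side is finite.
  have hfin : ratioMass a b' ε ≠ ⊤ := by
    obtain ⟨δ, hδ, h3⟩ := h2 ε (min_le_right _ _) 2 one_lt_two
    intro htop
    have h4 := h3 δ le_rfl
    rw [htop, ENNReal.top_mul (hne δ hδ), top_le_iff] at h4
    exact ENNReal.mul_ne_top ENNReal.ofReal_ne_top
      (ENNReal.mul_ne_top (measure_ne_top _ _) (ratioMass_zero_ne_top hn0 a δ)) h4
  by_contra hlt
  refine (ratioMass_lt_of_lt hn a hε (not_le.1 hlt) hfin).not_ge ?_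
  have hk : ∀ k : ℝ, 1 < k → ratioMass a b' ε ≤ ENNReal.ofReal (k * k) * ratioMass a b ε := by
    intro k hk
    obtain ⟨δ₁, hδ₁, h3⟩ := h1 ε (min_le_left _ _) k hk
    obtain ⟨δ₂, hδ₂, h4⟩ := h2 ε (min_le_right _ _) k hk
    rw [← ENNReal.mul_le_mul_iff_left (hne _ (lt_min hδ₁ hδ₂)) (measure_ne_top P _)]
    calc _ ≤ _ := h4 _ (min_le_right _ _)
      _ ≤ ENNReal.ofReal k * _ := mul_le_mul_right (h3 _ (min_le_left _ _)) _
      _ = _ := by rw [ENNReal.ofReal_mul (by linarith)]; ring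
  have hb_fin : ratioMass a b ε ≠ ⊤ :=
    ((ratioMass_lt_of_lt hn a hε (not_le.1 hlt) hfin).trans_le le_top).ne
  -- Letting `k` decrease to `1` removes the loss `k * k` and contradicts strict monotonicity in the
  -- exponent.
  have hlim : Filter.Tendsto (fun k : ℝ => ENNReal.ofReal (k * k) * ratioMass a b ε)
      (nhdsWithin 1 (Set.Ioi 1)) (nhds (ENNReal.ofReal (1 * 1) * ratioMass a b ε)) := by
    refine ENNReal.Tendsto.mul_const (ENNReal.tendsto_ofReal ?_) (Or.inr hb_fin)
    exact (Continuous.tendsto (by fun_prop) 1).mono_left nhdsWithin_le_nhds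
  rw [mul_one, ENNReal.ofReal_one, one_mul] at hlim
  exact ge_of_tendsto hlim (eventually_nhdsWithin_of_forall hk)

end Touching

/-! ### Convexity and touching points. -/

theorem exists_isLocalMax_of_not_convexOn {g : ℝ → ℝ} (hg : ContinuousOn g (Set.Ioi 0))
    (h : ¬ ConvexOn ℝ (Set.Ioi 0) g) :
    ∃ m₀ > 0, ∃ c, IsLocalMax (fun x => g x - c * x) m₀ := by
  rw [convexOn_iff_slope_mono_adjacent] at h
  push Not at h
  obtain ⟨x, y, z, hx, hz, hxy, hyz, hlt⟩ := h (convex_Ioi 0)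
  have hx0 : 0 < x := hx
  -- With the slope of the chord subtracted, the endpoint values agree and the value at `y` is
  -- larger, so a maximum over `[x, z]` is interior.
  set c := (g z - g x) / (z - x) with hc
  have hzx : 0 < z - x := by linarith
  have hcz : c * (z - x) = g z - g x := by rw [hc]; field_simp
  have hxy' : 0 < y - x := by linarith
  have hyz' : 0 < z - y := by linarith
  rw [div_lt_div_iff₀ hyz' hxy'] at hlt
  have hcont : ContinuousOn (fun t => g t - c * t) (Set.Icc x z) :=
    (hg.mono fun t ht => lt_of_lt_of_le hx0 ht.1).sub (by fun_prop)
  obtain ⟨m, hm, hmax⟩ := isCompact_Icc.exists_isMaxOn ⟨x, Set.left_mem_Icc.2 (by linarith)⟩ hcont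
  have hy := hmax (show y ∈ Set.Icc x z from ⟨hxy.le, hyz.le⟩)
  simp only [Set.mem_ofPred_eq] at hy
  have hgy : g x - c * x < g y - c * y := by
    have : (z - x) * (g x - c * x) < (z - x) * (g y - c * y) := by
      linear_combination hlt + (y - x) * hcz
    exact lt_of_mul_lt_mul_left this hzx.le
  have hm1 : m ≠ x := by
    rintro rfl
    linarith
  have hm2 : m ≠ z := by
    rintro rfl
    nlinarith
  have hmem : Set.Icc x z ∈ nhds m :=
    Icc_mem_nhds (lt_of_le_of_ne hm.1 hm1.symm) (lt_of_le_of_ne hm.2 hm2)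
  exact ⟨m, lt_of_lt_of_le hx0 hm.1, c, hmax.isLocalMax hmem⟩

theorem exists_isLocalMin_of_not_concaveOn {g : ℝ → ℝ} (hg : ContinuousOn g (Set.Ioi 0))
    (h : ¬ ConcaveOn ℝ (Set.Ioi 0) g) :
    ∃ m₀ > 0, ∃ c, IsLocalMin (fun x => g x - c * x) m₀ := by
  obtain ⟨m, hm, c, hc⟩ := exists_isLocalMax_of_not_convexOn hg.neg
    (fun h' => h (neg_convexOn_iff.1 h'))
  refine ⟨m, hm, -c, ?_⟩
  have := hc.neg
  convert! this using 2 with x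
  simp
  ring

theorem exists_affine_of_convexOn_of_concaveOn {g : ℝ → ℝ} (h1 : ConvexOn ℝ (Set.Ioi 0) g)
    (h2 : ConcaveOn ℝ (Set.Ioi 0) g) : ∃ p q : ℝ, ∀ x, 0 < x → g x = p + q * x := by
  have heq : ∀ x y s t : ℝ, 0 < x → 0 < y → 0 ≤ s → 0 ≤ t → s + t = 1 →
      g (s * x + t * y) = s * g x + t * g y := fun x y s t hx hy hs ht hst =>
    le_antisymm (h1.2 hx hy hs ht hst) (h2.2 hx hy hs ht hst)
  refine ⟨2 * g 1 - g 2, g 2 - g 1, fun x hx => ?_⟩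
  -- In each case the middle one of `x`, `1`, `2` is written as a convex combination of the other
  -- two.
  rcases le_or_gt x 1 with hx1 | hx1
  · have h0 : 0 < 2 - x := by linarith
    have h := heq x 2 (1 / (2 - x)) ((1 - x) / (2 - x)) hx two_pos (by positivity)
      (div_nonneg (by linarith) h0.le) (by field_simp; ring)
    have e : 1 / (2 - x) * x + (1 - x) / (2 - x) * 2 = 1 := by field_simp; ring
    rw [e] at h
    field_simp at h
    linarith
  rcases le_or_gt x 2 with hx2 | hx2
  · have h := heq 1 2 (2 - x) (x - 1) one_pos two_pos (by linarith) (by linarith) (by ring)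
    have e : (2 - x) * 1 + (x - 1) * 2 = x := by ring
    rw [e] at h
    linarith
  · have h0 : 0 < x - 1 := by linarith
    have h := heq 1 x ((x - 2) / (x - 1)) (1 / (x - 1)) one_pos hx
      (div_nonneg (by linarith) h0.le) (by positivity) (by field_simp; ring)
    have e : (x - 2) / (x - 1) * 1 + 1 / (x - 1) * x = 2 := by field_simp; ring
    rw [e] at h
    field_simp at h
    linarith

theorem le_mul_of_forall_gt {X Y β : ℝ} (h : ∀ b > β, X ≤ b * Y) : X ≤ β * Y := by
  have hlim : Filter.Tendsto (fun b : ℝ => b * Y) (nhdsWithin β (Set.Ioi β)) (nhds (β * Y)) :=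
    (Continuous.tendsto (by fun_prop) β).mono_left nhdsWithin_le_nhds
  exact ge_of_tendsto hlim (eventually_nhdsWithin_of_forall h)

/-- If the logarithmic tilts of `φ` that fail to be convex all have smaller exponents than those
that fail to be concave, then `φ` is a combination of `log` and an affine function. -/
theorem exists_eq_log_add_affine {φ : ℝ → ℝ}
    (h : ∀ b b' : ℝ, ¬ ConvexOn ℝ (Set.Ioi 0) (fun x => φ x - b * Real.log x) →
      ¬ ConcaveOn ℝ (Set.Ioi 0) (fun x => φ x - b' * Real.log x) → b ≤ b') :
    ∃ β p q : ℝ, ∀ x, 0 < x → φ x = β * Real.log x + (p + q * x) := by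
  have hD : 0 < Real.log 2 - (Real.log 1 + Real.log 3) / 2 := by
    have : Real.log 3 < Real.log (2 ^ 2) := Real.log_lt_log (by norm_num) (by norm_num)
    rw [Real.log_pow] at this
    push_cast at this
    rw [Real.log_one]
    linarith
  -- `D` is the midpoint Jensen gap of `log` on `1, 2, 3`, and `β` is the exponent for which the gap
  -- of `φ - β log` vanishes. Convexity at `b` thus gives `β ≤ b`, and concavity gives `b ≤ β`.
  set D := Real.log 2 - (Real.log 1 + Real.log 3) / 2 with hDdef
  set β := (φ 2 - (φ 1 + φ 3) / 2) / D with hβ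
  have hβD : β * D = φ 2 - (φ 1 + φ 3) / 2 := by rw [hβ]; field_simp
  have e2 : (1 / 2 : ℝ) * 1 + 1 / 2 * 3 = 2 := by norm_num
  have hconv : ∀ b, ConvexOn ℝ (Set.Ioi 0) (fun x => φ x - b * Real.log x) → β ≤ b := by
    intro b hb
    have h1 := hb.2 (show (1 : ℝ) ∈ Set.Ioi 0 by norm_num) (show (3 : ℝ) ∈ Set.Ioi 0 by norm_num)
      (show (0 : ℝ) ≤ 1 / 2 by norm_num) (show (0 : ℝ) ≤ 1 / 2 by norm_num) (by norm_num)
    simp only [smul_eq_mul, e2] at h1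
    refine le_of_mul_le_mul_right ?_ hD
    rw [hβD, hDdef]
    linarith
  have hconc : ∀ b, ConcaveOn ℝ (Set.Ioi 0) (fun x => φ x - b * Real.log x) → b ≤ β := by
    intro b hb
    have h1 := hb.2 (show (1 : ℝ) ∈ Set.Ioi 0 by norm_num) (show (3 : ℝ) ∈ Set.Ioi 0 by norm_num)
      (show (0 : ℝ) ≤ 1 / 2 by norm_num) (show (0 : ℝ) ≤ 1 / 2 by norm_num) (by norm_num)
    simp only [smul_eq_mul, e2] at h1
    refine le_of_mul_le_mul_right ?_ hD
    rw [hβD, hDdef]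
    linarith
  have hgt : ∀ b > β, ConvexOn ℝ (Set.Ioi 0) (fun x => φ x - b * Real.log x) := by
    intro b hb
    by_contra hnot
    -- Concavity fails at the intermediate `b' > β`, so failure of convexity at `b` would give `b ≤
    -- b'`.
    obtain ⟨b', h1, h2⟩ := exists_between hb
    exact absurd (h b b' hnot fun h3 => absurd (hconc b' h3) (not_le.2 h1)) (not_le.2 h2)
  have hlt : ∀ b < β, ConcaveOn ℝ (Set.Ioi 0) (fun x => φ x - b * Real.log x) := by
    intro b hb
    by_contra hnot
    obtain ⟨b', h1, h2⟩ := exists_between hb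
    exact absurd (h b' b (fun h3 => absurd (hconv b' h3) (not_le.2 h2)) hnot) (not_le.2 h1)
  -- Each instance of the convexity inequality is affine in the exponent, so it survives the limit
  -- `b ↓ β`.
  have hcv : ConvexOn ℝ (Set.Ioi 0) (fun x => φ x - β * Real.log x) := by
    refine ⟨convex_Ioi 0, fun x hx y hy s t hs ht hst => ?_⟩
    have := le_mul_of_forall_gt (X := φ (s • x + t • y) - (s • φ x + t • φ y))
      (Y := Real.log (s • x + t • y) - (s • Real.log x + t • Real.log y)) (β := β) fun b hb => by
        have := (hgt b hb).2 hx hy hs ht hst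
        simp only [smul_eq_mul] at this ⊢
        linarith
    simp only [smul_eq_mul] at this ⊢
    linarith
  have hcc : ConcaveOn ℝ (Set.Ioi 0) (fun x => φ x - β * Real.log x) := by
    refine ⟨convex_Ioi 0, fun x hx y hy s t hs ht hst => ?_⟩
    have := le_mul_of_forall_gt (X := -(φ (s • x + t • y) - (s • φ x + t • φ y)))
      (Y := Real.log (s • x + t • y) - (s • Real.log x + t • Real.log y)) (β := -β) fun b hb => by
        have := (hlt (-b) (by linarith)).2 hx hy hs ht hst
        simp only [smul_eq_mul] at this ⊢
        linarith
    simp only [smul_eq_mul] at this ⊢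
    linarith
  obtain ⟨p, q, hpq⟩ := exists_affine_of_convexOn_of_concaveOn hcv hcc
  exact ⟨β, p, q, fun x hx => by linarith [hpq x hx]⟩

theorem exp_log_tilt {b c v x : ℝ} (hx : 0 < x) :
    Real.exp v * x ^ b * Real.exp (-(-c * x)) = Real.exp (v + b * Real.log x + c * x) := by
  rw [Real.rpow_def_of_pos hx, ← Real.exp_add, ← Real.exp_add]
  congr 1
  ring

/-! ### The characterisation. -/

theorem corollary6 {Ω : Type*} [MeasurableSpace Ω] (μ : Measure Ω) [IsProbabilityMeasure μ]
    (n : ℕ) (hn : 3 ≤ n)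
    (F : Measure ℝ) (f : ℝ → ℝ)
    (hf_zero : ∀ x ≤ 0, f x = 0)
    (hf_pos : ∀ x, 0 < x → 0 < f x)
    (hf_cont : ContinuousOn f (Set.Ioi 0))
    (hF : F = volume.withDensity (fun x => ENNReal.ofReal (f x)))
    (X : Fin n → Ω → ℝ)
    (hX_meas : ∀ i, Measurable (X i))
    (hX_indep : iIndepFun X μ)
    (hX_law : ∀ i, μ.map (X i) = F)
    (a : Matrix (Fin n) (Fin n) ℝ)
    (ha : ∀ v : Fin n → ℝ, v ≠ 0 → 0 < ∑ i, ∑ j, a i j * v i * v j) :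
    IndepFun (fun ω => sampleMean (fun i => X i ω))
        (fun ω => Real.sqrt (quadStat a (fun i => X i ω)) / sampleMean (fun i => X i ω)) μ ↔
      IsGammaDistribution F := by
  have hY : Measurable (fun ω i => X i ω) := measurable_pi_lambda _ hX_meas
  have hFprob : IsProbabilityMeasure F := by
    rw [← hX_law ⟨0, by omega⟩]
    exact Measure.isProbabilityMeasure_map (hX_meas _).aemeasurable
  constructor
  · intro hind
    have hind' := (indepFun_comp_iff hY measurable_sampleMean (measurable_ratioStat a)).1 hind
    have hfm : Measurable f := by
      have h1 : (Set.Ioi 0).piecewise f 0 = f := by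
        ext x
        by_cases hx : x ∈ Set.Ioi 0
        · rw [Set.piecewise_eq_of_mem _ _ _ hx]
        · rw [Set.piecewise_eq_of_notMem _ _ _ hx, hf_zero x (not_lt.1 hx), Pi.zero_apply]
      rw [← h1]
      exact hf_cont.measurable_piecewise continuousOn_const measurableSet_Ioi
    have hP := map_eq_withDensity hfm.ennreal_ofReal hF hX_meas hX_indep hX_law
    have := Measure.isProbabilityMeasure_map (μ := μ) hY.aemeasurable
    have hcont : ∀ b, ContinuousOn (fun x => Real.log (f x) - b * Real.log x) (Set.Ioi 0) :=
      fun b => (hf_cont.log fun x hx => (hf_pos x hx).ne').sub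
        (continuousOn_const.mul (continuousOn_id.log fun x hx => (ne_of_gt hx)))
    obtain ⟨β, p, q, h⟩ := exists_eq_log_add_affine (φ := fun x => Real.log (f x))
        fun b b' hb hb' => by
      obtain ⟨m₀, hm₀, c, hmax⟩ := exists_isLocalMax_of_not_convexOn (hcont b) hb
      obtain ⟨m₁, hm₁, c', hmin⟩ := exists_isLocalMin_of_not_concaveOn (hcont b') hb'
      -- The constants `q` and `q'` make each kernel equal to `f` at its extremum; the local
      -- extremality of the tilted logarithm is then the one-sided bound nearby.
      refine exponent_le_of_touching (by omega) ha hf_zero hf_pos hf_cont hfm hP hind' hm₀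
        (q := Real.exp (Real.log (f m₀) - b * Real.log m₀ - c * m₀)) (c := -c) ?_ ?_ hm₁
        (q' := Real.exp (Real.log (f m₁) - b' * Real.log m₁ - c' * m₁)) (c' := -c')
        (Real.exp_pos _) ?_ ?_
      · rw [exp_log_tilt hm₀, ← Real.exp_log (hf_pos _ hm₀), Real.log_exp]
        congr 1
        ring
      · filter_upwards [hmax, lt_mem_nhds hm₀] with y hy hy0
        rw [exp_log_tilt hy0, ← Real.log_le_iff_le_exp (hf_pos y hy0)]
        linarith
      · rw [exp_log_tilt hm₁, ← Real.exp_log (hf_pos _ hm₁), Real.log_exp]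
        congr 1
        ring
      · filter_upwards [hmin, lt_mem_nhds hm₁] with y hy hy0
        rw [exp_log_tilt hy0, ← Real.le_log_iff_exp_le (hf_pos y hy0)]
        linarith
    refine isGammaDistribution_of_density hf_zero hF (Real.exp_pos p) (b := β) (c := -q)
      fun x hx => ?_
    rw [exp_log_tilt hx, ← Real.exp_log (hf_pos x hx), h x hx]
    congr 1
    ring
  · rintro ⟨α, θ, hα, hθ, rfl⟩
    exact indepFun_of_gammaMeasure (by omega) hα (one_div_pos.2 hθ) hX_meas hX_indep hX_law a
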